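/- Let $\Gamma$ be a totally ordered abelian discrete group with positive cone $\Gamma^+=\{x\in\Gamma:x\ge 0\}$, let $A$ be a $C^*$-algebra, and let $\alpha:\Gamma^+\to\operatorname{Aut}(A)$ be an action of $\Gamma^+$ by automorphisms with $\alpha_0=\mathrm{id}$, extended to an action of $\Gamma$ by $\alpha_s:=\alpha_{-s}^{-1}$ for $s<0$. For $x\in\Gamma$ and $a\in A$ let $\mu_x(a)\in\ell^\infty(\Gamma,A)$ be given by $\mu_x(a)(y)=\alpha_{y-x}(a)$ if $y\ge x$ and $\mu_x(a)(y)=0$ if $y<x$. Let $\mathcal B$ be the $C^*$-subalgebra of $\ell^\infty(\Gamma,A)$ generated by all $\mu_x(a)$, let $\mathcal I$ be the ideal of $\mathcal B$ that is generated, as a $C^*$-subalgebra, by the elements $\mu_x(a)-\mu_y(\alpha_{y-x}(a))$ with $x<y$ in $\Gamma$ and $a\in A$, and let $\beta$ be the action of $\Gamma$ on $\mathcal B$ by the shift, $(\beta_s\xi)(y)=\xi(y-s)$, so that $\beta_s(\mu_x(a))=\mu_{x+s}(a)$. For $s\in\Gamma$ let $1_s\in\ell^\infty(\Gamma)$ be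 the indicator function of $\{t:t\ge s\}$. Let $B_\Gamma$ be the closed linear span of $\{1_s:s\in\Gamma\}$, a $C^*$-subalgebra of $\ell^\infty(\Gamma)$, let $B_{\Gamma,\infty}$ be the closed linear span of $\{1_s-1_t:s<t\}$, an ideal of $B_\Gamma$, and let $\tau$ be the action of $\Gamma$ on $B_\Gamma$ by translation, $\tau_x(1_s)=1_{s+x}$. Let $\tau\otimes\alpha^{-1}$ be the action $x\mapsto\tau_x\otimes\alpha_x^{-1}$ of $\Gamma$ on the $C^*$-tensor product $B_\Gamma\otimes A$; it leaves the ideal $B_{\Gamma,\infty}\otimes A$ invariant. Then there is a $*$-isomorphism $\delta:B_\Gamma\otimes A\to\mathcal B$ such that $\beta_x(\delta(\xi))=\delta((\tau\otimes\alpha^{-1})_x(\xi))$ for all $\xi\in B_\Gamma\otimes A$ and $x\in\Gamma$, and $\delta$ maps the ideal $B_{\Gamma,\infty}\otimes A$ onto $\mathcal I$. Moreover, let $((B_\Gamma\otimes A)\times_{\tau\otimes\alpha^{-1}}\Gamma,k)$ and $(\mathcal B\times_\beta\Gamma,j)$ be the (full) group crossed products with their canonical homomorphisms $k_{B_\Gamma\otimes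 A}$, $j_{\mathcal B}$ of the algebras into the crossed products, and $k_\Gamma$, $j_\Gamma$ of $\Gamma$ into the multiplier algebras of the crossed products. Then $\delta$ induces a $*$-isomorphism $\Delta$ of $(B_\Gamma\otimes A)\times_{\tau\otimes\alpha^{-1}}\Gamma$ onto $\mathcal B\times_\beta\Gamma$ such that $$\Delta\big(k_{B_\Gamma\otimes A}(\xi)\,k_\Gamma(s)\big)=j_{\mathcal B}(\delta(\xi))\,j_\Gamma(s)\quad\text{for all }\xi\in B_\Gamma\otimes A,\ s\in\Gamma,$$ and $\Delta$ maps the ideal $(B_{\Gamma,\infty}\otimes A)\times_{\tau\otimes\alpha^{-1}}\Gamma$ onto $\mathcal I\times_\beta\Gamma$, where these crossed products are identified with their canonical images in $(B_\Gamma\otimes A)\times_{\tau\otimes\alpha^{-1}}\Gamma$ and $\mathcal B\times_\beta\Gamma$. -/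

import Mathlib

open scoped TensorProduct ENNReal MultiplierAlgebra

noncomputable section

namespace PisoCrossed

/-! ### Completion of a `*`-algebra in a `C*`-seminorm -/

/-- A `C*`-seminorm on a complex `*`-algebra: a submultiplicative seminorm `p` with
`p (x* x) = p x ^ 2`. -/
structure CStarSeminorm (X : Type*) [NonUnitalRing X] [StarRing X] [Module ℂ X]
    extends Seminorm ℂ X where
  mul_le' : ∀ x y : X, toFun (x * y) ≤ toFun x * toFun y
  star_mul_self' : ∀ x : X, toFun (star x * x) = toFun x * toFun x

section Completion

variable {X : Type*} [NonUnitalRing X] [StarRing X] [Module ℂ X]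

/-- The `*`-algebra `X`, topologized by the seminorm `p`. -/
def Pre (_p : CStarSeminorm X) : Type _ := X

variable (p : CStarSeminorm X)

instance : NonUnitalRing (Pre p) := inferInstanceAs (NonUnitalRing X)
instance : StarRing (Pre p) := inferInstanceAs (StarRing X)
instance : Module ℂ (Pre p) := inferInstanceAs (Module ℂ X)
instance [StarModule ℂ X] : StarModule ℂ (Pre p) := inferInstanceAs (StarModule ℂ X)
instance [IsScalarTower ℂ X X] : IsScalarTower ℂ (Pre p) (Pre p) :=
  inferInstanceAs (IsScalarTower ℂ X X)
instance [SMulCommClass ℂ X X] : SMulCommClass ℂ (Pre p) (Pre p) :=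
  inferInstanceAs (SMulCommClass ℂ X X)

instance : NonUnitalSeminormedRing (Pre p) where
  toNonUnitalRing := inferInstance
  norm x := p.toSeminorm x
  dist x y := p.toSeminorm (-x + y)
  dist_self x := by
    rw [neg_add_cancel]; exact map_zero p.toSeminorm
  dist_comm x y := by
    have h : -y + x = -(-x + y) := by abel
    rw [h]; exact (map_neg_eq_map p.toSeminorm (-x + y : Pre p)).symm
  dist_triangle x y z := by
    have h : -x + z = (-x + y) + (-y + z) := by abel
    rw [h]; exact map_add_le_add p.toSeminorm (-x + y : Pre p) (-y + z : Pre p)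
  dist_eq _ _ := rfl
  norm_mul_le := p.mul_le'

instance : NormedSpace ℂ (Pre p) where
  norm_smul_le c x := (map_smul_eq_mul p.toSeminorm c x).le

theorem norm_star_pre (x : Pre p) : ‖star x‖ = ‖x‖ := by
  have key : ∀ y : Pre p, ‖y‖ ≤ ‖star y‖ := fun y => by
    have h1 : ‖y‖ * ‖y‖ ≤ ‖star y‖ * ‖y‖ :=
      (p.star_mul_self' y).symm.le.trans (p.mul_le' (star y) y)
    rcases (norm_nonneg y).eq_or_lt with h | h
    · rw [← h]; exact norm_nonneg _
    · exact le_of_mul_le_mul_right h1 h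
  refine le_antisymm ?_ (key x)
  simpa using key (star x)

/-- The Hausdorff completion of the `*`-algebra `X` in the `C*`-seminorm `p`. -/
abbrev CStarCompletion : Type _ := UniformSpace.Completion (Pre p)

namespace CStarCompletion

open UniformSpace Function

variable {p} in
/-- The canonical map of `X` into its completion. -/
def mk (x : X) : CStarCompletion p := ((show Pre p from x : Pre p) : Completion (Pre p))

theorem mk_add (x y : X) : (mk (x + y) : CStarCompletion p) = mk x + mk y :=
  Completion.coe_add (α := Pre p) x y
theorem mk_zero : (mk (0 : X) : CStarCompletion p) = 0 := rfl
theorem mk_smul (c : ℂ) (x : X) : (mk (c • x) : CStarCompletion p) = c • mk x :=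
  Completion.coe_smul (X := Pre p) c x
theorem norm_mk (x : X) : ‖(mk x : CStarCompletion p)‖ = p.toSeminorm x :=
  Completion.norm_coe (E := Pre p) x

theorem denseRange_mk : DenseRange (mk : X → CStarCompletion p) :=
  Completion.denseRange_coe (α := Pre p)

variable {p}

@[elab_as_elim]
theorem induction_on {P : CStarCompletion p → Prop} (a : CStarCompletion p)
    (hp : IsClosed {a | P a}) (ih : ∀ x : X, P (mk x)) : P a :=
  Completion.induction_on (α := Pre p) a hp ih

@[elab_as_elim]
theorem induction_on₂ {P : CStarCompletion p → CStarCompletion p → Prop}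
    (a b : CStarCompletion p)
    (hp : IsClosed {x : CStarCompletion p × CStarCompletion p | P x.1 x.2})
    (ih : ∀ x y : X, P (mk x) (mk y)) : P a b :=
  Completion.induction_on₂ (α := Pre p) (β := Pre p) a b hp ih

@[elab_as_elim]
theorem induction_on₃ {P : CStarCompletion p → CStarCompletion p → CStarCompletion p → Prop}
    (a b c : CStarCompletion p)
    (hp : IsClosed {x : CStarCompletion p × CStarCompletion p × CStarCompletion p |
      P x.1 x.2.1 x.2.2})
    (ih : ∀ x y z : X, P (mk x) (mk y) (mk z)) : P a b c :=
  Completion.induction_on₃ (α := Pre p) (β := Pre p) (γ := Pre p) a b c hp ih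

instance : Mul (CStarCompletion p) :=
  ⟨curry <| ((Completion.isDenseInducing_coe (α := Pre p)).prodMap
    (Completion.isDenseInducing_coe (α := Pre p))).extend
      (fun x : Pre p × Pre p => ((x.1 * x.2 : Pre p) : Completion (Pre p)))⟩

theorem mk_mul (x y : X) : (mk (x * y) : CStarCompletion p) = mk x * mk y :=
  (((Completion.isDenseInducing_coe (α := Pre p)).prodMap
    (Completion.isDenseInducing_coe (α := Pre p))).extend_eq
      ((Completion.continuous_coe (Pre p)).comp (@continuous_mul (Pre p) _ _ _)) (x, y)).symm

instance : ContinuousMul (CStarCompletion p) where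
  continuous_mul := by
    let m := (AddMonoidHom.mul : Pre p →+ Pre p →+ Pre p).compr₂ Completion.toCompl
    have : Continuous fun q : Pre p × Pre p => m q.1 q.2 :=
      (Completion.continuous_coe (Pre p)).comp continuous_mul
    have di : IsDenseInducing (Completion.toCompl : Pre p → Completion (Pre p)) :=
      Completion.isDenseInducing_coe
    exact (di.extend_Z_bilin di this :)

instance : Star (CStarCompletion p) :=
  ⟨Completion.map (fun x : Pre p => star x)⟩

theorem isometry_star_pre : Isometry (fun x : Pre p => star x) :=
  Isometry.of_dist_eq fun x y => by
    rw [dist_eq_norm, dist_eq_norm, ← star_sub, norm_star_pre]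

theorem mk_star (x : X) : (mk (star x) : CStarCompletion p) = star (mk x) :=
  (Completion.map_coe (isometry_star_pre (p := p)).uniformContinuous x).symm

theorem continuous_star' : Continuous (star : CStarCompletion p → CStarCompletion p) :=
  Completion.continuous_map

instance : NonUnitalRing (CStarCompletion p) where
  __ : AddCommGroup (CStarCompletion p) := inferInstance
  zero_mul a := induction_on a (isClosed_eq (by fun_prop) continuous_const)
    fun a => by rw [← mk_zero, ← mk_mul, zero_mul]
  mul_zero a := induction_on a (isClosed_eq (by fun_prop) continuous_const)
    fun a => by rw [← mk_zero, ← mk_mul, mul_zero]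
  mul_assoc a b c := induction_on₃ a b c (isClosed_eq (by fun_prop) (by fun_prop))
    fun a b c => by rw [← mk_mul, ← mk_mul, ← mk_mul, ← mk_mul, mul_assoc]
  left_distrib a b c := induction_on₃ a b c (isClosed_eq (by fun_prop) (by fun_prop))
    fun a b c => by rw [← mk_add, ← mk_mul, ← mk_mul, ← mk_mul, ← mk_add, mul_add]
  right_distrib a b c := induction_on₃ a b c (isClosed_eq (by fun_prop) (by fun_prop))
    fun a b c => by rw [← mk_add, ← mk_mul, ← mk_mul, ← mk_mul, ← mk_add, add_mul]

instance : StarRing (CStarCompletion p) where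
  star_involutive a := induction_on a
    (isClosed_eq (continuous_star'.comp continuous_star') continuous_id)
    fun a => by rw [← mk_star, ← mk_star, star_star]
  star_mul a b := induction_on₂ a b
    (isClosed_eq (continuous_star'.comp (by fun_prop))
      ((continuous_star'.comp continuous_snd).mul (continuous_star'.comp continuous_fst)))
    fun a b => by rw [← mk_mul, ← mk_star, ← mk_star, ← mk_star, ← mk_mul, star_mul]
  star_add a b := induction_on₂ a b
    (isClosed_eq (continuous_star'.comp (by fun_prop))
      ((continuous_star'.comp continuous_fst).add (continuous_star'.comp continuous_snd)))
    fun a b => by rw [← mk_add, ← mk_star, ← mk_star, ← mk_star, ← mk_add, star_add]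

instance : NonUnitalNormedRing (CStarCompletion p) where
  __ : NormedAddCommGroup (CStarCompletion p) := inferInstance
  __ : NonUnitalRing (CStarCompletion p) := inferInstance
  norm_mul_le a b := induction_on₂ a b
    (isClosed_le (by fun_prop) (by fun_prop))
    fun a b => by rw [← mk_mul, norm_mk, norm_mk, norm_mk]; exact p.mul_le' a b

instance [IsScalarTower ℂ X X] : IsScalarTower ℂ (CStarCompletion p) (CStarCompletion p) where
  smul_assoc c a b := by
    change (c • a) * b = c • (a * b)
    induction a, b using induction_on₂ with
    | hp =>
      exact isClosed_eq ((continuous_fst.const_smul c).mul continuous_snd)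
        ((continuous_fst.mul continuous_snd).const_smul c)
    | ih a b => rw [← mk_smul, ← mk_mul, ← mk_mul, ← mk_smul, smul_mul_assoc]

instance [SMulCommClass ℂ X X] : SMulCommClass ℂ (CStarCompletion p) (CStarCompletion p) where
  smul_comm c a b := by
    change c • (a * b) = a * (c • b)
    induction a, b using induction_on₂ with
    | hp =>
      exact isClosed_eq ((continuous_fst.mul continuous_snd).const_smul c)
        (continuous_fst.mul (continuous_snd.const_smul c))
    | ih a b => rw [← mk_smul, ← mk_mul, ← mk_mul, ← mk_smul, mul_smul_comm]

instance [StarModule ℂ X] : StarModule ℂ (CStarCompletion p) where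
  star_smul c a := by
    induction a using induction_on with
    | hp =>
      exact isClosed_eq (continuous_star'.comp (continuous_const_smul c))
        (continuous_star'.const_smul (star c))
    | ih a => rw [← mk_smul, ← mk_star, ← mk_star, ← mk_smul, star_smul]

instance : CStarRing (CStarCompletion p) where
  norm_mul_self_le a := induction_on a
    (isClosed_le (by fun_prop) (continuous_norm.comp (continuous_star'.mul continuous_id)))
    fun a => by
      rw [← mk_star, ← mk_mul, norm_mk, norm_mk]
      exact (p.star_mul_self' a).symm.le

instance [StarModule ℂ X] [IsScalarTower ℂ X X] [SMulCommClass ℂ X X] :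
    NonUnitalCStarAlgebra (CStarCompletion p) where

variable (p) in
/-- The canonical `*`-homomorphism of `X` into its completion. -/
def mkHom : X →⋆ₙₐ[ℂ] CStarCompletion p where
  toFun := mk
  map_smul' := mk_smul p
  map_zero' := rfl
  map_add' := mk_add p
  map_mul' := mk_mul
  map_star' := mk_star

/-- A linear map that does not increase the seminorms, as a continuous linear map. -/
def preMap {Y : Type*} [NonUnitalRing Y] [StarRing Y] [Module ℂ Y] {q : CStarSeminorm Y}
    (f : X →ₗ[ℂ] Y) (hf : ∀ x, q.toSeminorm (f x) ≤ p.toSeminorm x) : Pre p →L[ℂ] Pre q :=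
  LinearMap.mkContinuous
    { toFun := fun x => (f x : Y), map_add' := f.map_add, map_smul' := f.map_smul } 1
    (fun x => by rw [one_mul]; exact hf x)

theorem completion_preMap_mk {Y : Type*} [NonUnitalRing Y] [StarRing Y] [Module ℂ Y]
    {q : CStarSeminorm Y} (f : X →ₗ[ℂ] Y) (hf : ∀ x, q.toSeminorm (f x) ≤ p.toSeminorm x)
    (x : X) : (Completion.map (preMap f hf) (mk x : CStarCompletion p) : CStarCompletion q) =
      mk (f x) :=
  Completion.map_coe (preMap f hf).uniformContinuous x

theorem continuous_completion_preMap {Y : Type*} [NonUnitalRing Y] [StarRing Y] [Module ℂ Y]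
    {q : CStarSeminorm Y} (f : X →ₗ[ℂ] Y) (hf : ∀ x, q.toSeminorm (f x) ≤ p.toSeminorm x) :
    Continuous (fun x : CStarCompletion p =>
      (Completion.map (preMap f hf) x : CStarCompletion q)) :=
  Completion.continuous_map

/-- The extension to the completion of a linear map that does not increase the seminorms. -/
def mapL {Y : Type*} [NonUnitalRing Y] [StarRing Y] [Module ℂ Y] {q : CStarSeminorm Y}
    (f : X →ₗ[ℂ] Y) (hf : ∀ x, q.toSeminorm (f x) ≤ p.toSeminorm x) :
    CStarCompletion p →L[ℂ] CStarCompletion q where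
  toFun x := Completion.map (preMap f hf) x
  map_add' a b := by
    have hc := continuous_completion_preMap f hf
    induction a, b using induction_on₂ with
    | hp =>
      exact isClosed_eq (hc.comp continuous_add)
        ((hc.comp continuous_fst).add (hc.comp continuous_snd))
    | ih a b =>
      have h := completion_preMap_mk f hf
      rw [← mk_add, h, h, h, map_add, mk_add]
  map_smul' c a := by
    have hc := continuous_completion_preMap f hf
    induction a using induction_on with
    | hp => exact isClosed_eq (hc.comp (continuous_const_smul c)) (hc.const_smul c)
    | ih a =>
      have h := completion_preMap_mk f hf
      rw [← mk_smul, h, h, map_smul, mk_smul]; rfl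
  cont := continuous_completion_preMap f hf

theorem mapL_mk {Y : Type*} [NonUnitalRing Y] [StarRing Y] [Module ℂ Y] {q : CStarSeminorm Y}
    (f : X →ₗ[ℂ] Y) (hf : ∀ x, q.toSeminorm (f x) ≤ p.toSeminorm x) (x : X) :
    mapL f hf (mk x) = mk (f x) :=
  completion_preMap_mk f hf x

/-- The extension to the completion of a `*`-homomorphism that does not increase the
seminorms. -/
def map {Y : Type*} [NonUnitalRing Y] [StarRing Y] [Module ℂ Y] {q : CStarSeminorm Y}
    (f : X →⋆ₙₐ[ℂ] Y) (hf : ∀ x, q.toSeminorm (f x) ≤ p.toSeminorm x) :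
    CStarCompletion p →⋆ₙₐ[ℂ] CStarCompletion q :=
  let f' : X →ₗ[ℂ] Y := { toFun := f, map_add' := map_add f, map_smul' := map_smul f }
  { toFun := mapL f' hf
    map_smul' := (mapL f' hf).map_smul
    map_zero' := (mapL f' hf).map_zero
    map_add' := (mapL f' hf).map_add
    map_mul' := fun a b => by
      induction a, b using induction_on₂ with
      | hp => exact isClosed_eq (by fun_prop) (by fun_prop)
      | ih a b =>
        rw [← mk_mul, mapL_mk, mapL_mk, mapL_mk, ← mk_mul]; exact congrArg mk (map_mul f a b)
    map_star' := fun a => by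
      induction a using induction_on with
      | hp =>
      exact isClosed_eq ((mapL f' hf).continuous.comp continuous_star')
          (continuous_star'.comp (mapL f' hf).continuous)
      | ih a =>
        rw [← mk_star, mapL_mk, mapL_mk, ← mk_star]; exact congrArg mk (map_star f a) }

theorem map_mk {Y : Type*} [NonUnitalRing Y] [StarRing Y] [Module ℂ Y] {q : CStarSeminorm Y}
    (f : X →⋆ₙₐ[ℂ] Y) (hf : ∀ x, q.toSeminorm (f x) ≤ p.toSeminorm x) (x : X) :
    map f hf (mk x) = mk (f x) :=
  mapL_mk (q := q)
    ({ toFun := f, map_add' := map_add f, map_smul' := map_smul f } : X →ₗ[ℂ] Y) hf x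

theorem continuous_map {Y : Type*} [NonUnitalRing Y] [StarRing Y] [Module ℂ Y]
    {q : CStarSeminorm Y} (f : X →⋆ₙₐ[ℂ] Y) (hf : ∀ x, q.toSeminorm (f x) ≤ p.toSeminorm x) :
    Continuous (map f hf) :=
  (mapL (q := q)
    ({ toFun := f, map_add' := map_add f, map_smul' := map_smul f } : X →ₗ[ℂ] Y) hf).continuous

end CStarCompletion

/-- The `C*`-seminorm `x ↦ ‖ρ x‖` of a `*`-homomorphism `ρ` into a `C*`-algebra. -/
def CStarSeminorm.ofHom {E : Type*} [NonUnitalCStarAlgebra E] (ρ : X →⋆ₙₐ[ℂ] E) :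
    CStarSeminorm X where
  toSeminorm := (normSeminorm ℂ E).comp (ρ : X →ₗ[ℂ] E)
  mul_le' x y := by
    change ‖ρ (x * y)‖ ≤ ‖ρ x‖ * ‖ρ y‖
    rw [map_mul]; exact norm_mul_le _ _
  star_mul_self' x := by
    change ‖ρ (star x * x)‖ = ‖ρ x‖ * ‖ρ x‖
    rw [map_mul, map_star]; exact CStarRing.norm_star_mul_self

/-- The pointwise supremum of a pointwise bounded set of `C*`-seminorms. -/
def CStarSeminorm.sup (S : Set (CStarSeminorm X))
    (hb : ∀ x, BddAbove {r : ℝ | ∃ q ∈ S, r = q.toSeminorm x}) : CStarSeminorm X :=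
  have nn : ∀ x, 0 ≤ sSup {r : ℝ | ∃ q ∈ S, r = q.toSeminorm x} := fun x =>
    Real.sSup_nonneg (by rintro r ⟨q, -, rfl⟩; exact apply_nonneg _ _)
  have le : ∀ q ∈ S, ∀ x, q.toSeminorm x ≤ sSup {r : ℝ | ∃ q ∈ S, r = q.toSeminorm x} :=
    fun q hq x => le_csSup (hb x) ⟨q, hq, rfl⟩
  { toSeminorm := Seminorm.ofSMulLE (fun x => sSup {r : ℝ | ∃ q ∈ S, r = q.toSeminorm x})
      (by
        refine le_antisymm (Real.sSup_le ?_ le_rfl) (nn 0)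
        rintro r ⟨q, hq, rfl⟩
        rw [map_zero])
      (by
        intro x y
        refine Real.sSup_le ?_ (add_nonneg (nn x) (nn y))
        rintro r ⟨q, hq, rfl⟩
        exact (map_add_le_add q.toSeminorm x y).trans (add_le_add (le q hq x) (le q hq y)))
      (by
        intro c x
        refine Real.sSup_le ?_ (mul_nonneg (norm_nonneg _) (nn x))
        rintro r ⟨q, hq, rfl⟩
        rw [map_smul_eq_mul]
        exact mul_le_mul_of_nonneg_left (le q hq x) (norm_nonneg _))
    mul_le' := by
      intro x y
      refine Real.sSup_le ?_ (mul_nonneg (nn x) (nn y))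
      rintro r ⟨q, hq, rfl⟩
      exact (q.mul_le' x y).trans
        (mul_le_mul (le q hq x) (le q hq y) (apply_nonneg q.toSeminorm y) (nn x))
    star_mul_self' := by
      intro x
      refine le_antisymm (Real.sSup_le ?_ (mul_nonneg (nn x) (nn x))) ?_
      · rintro r ⟨q, hq, rfl⟩
        exact (q.star_mul_self' x).le.trans
          (mul_le_mul (le q hq x) (le q hq x) (apply_nonneg q.toSeminorm x) (nn x))
      · have h : sSup {r : ℝ | ∃ q ∈ S, r = q.toSeminorm x} ≤
            Real.sqrt (sSup {r : ℝ | ∃ q ∈ S, r = q.toSeminorm (star x * x)}) := by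
          refine Real.sSup_le ?_ (Real.sqrt_nonneg _)
          rintro r ⟨q, hq, rfl⟩
          refine Real.le_sqrt_of_sq_le ?_
          rw [sq]
          exact (q.star_mul_self' x).symm.le.trans (le q hq (star x * x))
        have h2 := mul_le_mul h h (nn x) (Real.sqrt_nonneg _)
        rwa [Real.mul_self_sqrt (nn _)] at h2 }

theorem CStarSeminorm.sup_le {S : Set (CStarSeminorm X)}
    {hb : ∀ x, BddAbove {r : ℝ | ∃ q ∈ S, r = q.toSeminorm x}} {x : X} {c : ℝ} (hc : 0 ≤ c)
    (h : ∀ q ∈ S, q.toSeminorm x ≤ c) : (CStarSeminorm.sup S hb).toSeminorm x ≤ c :=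
  Real.sSup_le (by rintro r ⟨q, hq, rfl⟩; exact h q hq) hc

theorem CStarSeminorm.le_sup {S : Set (CStarSeminorm X)}
    {hb : ∀ x, BddAbove {r : ℝ | ∃ q ∈ S, r = q.toSeminorm x}} {q : CStarSeminorm X}
    (hq : q ∈ S) (x : X) : q.toSeminorm x ≤ (CStarSeminorm.sup S hb).toSeminorm x :=
  le_csSup (hb x) ⟨q, hq, rfl⟩

end Completion

/-! ### The maximal tensor product -/

universe u v w

section Tensor

/-- A pair of `*`-homomorphisms of `C` and `D` into a `C*`-algebra `E` with commuting ranges. -/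
structure CommutingPair (C : Type u) (D : Type v) (E : Type w) [NonUnitalCStarAlgebra C]
    [NonUnitalCStarAlgebra D] [NonUnitalCStarAlgebra E] where
  left : C →⋆ₙₐ[ℂ] E
  right : D →⋆ₙₐ[ℂ] E
  comm : ∀ c d, left c * right d = right d * left c

/-- The `*`-homomorphism `c ⊗ d ↦ left c * right d` of the algebraic tensor product. -/
def CommutingPair.hom {C : Type u} {D : Type v} {E : Type w} [NonUnitalCStarAlgebra C]
    [NonUnitalCStarAlgebra D] [NonUnitalCStarAlgebra E] (P : CommutingPair C D E) :
    C ⊗[ℂ] D →⋆ₙₐ[ℂ] E :=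
  let f : C ⊗[ℂ] D →ₗ[ℂ] E := TensorProduct.lift
    ((LinearMap.mul ℂ E).compl₁₂ (P.left : C →ₗ[ℂ] E) (P.right : D →ₗ[ℂ] E))
  have hf : ∀ c d, f (c ⊗ₜ d) = P.left c * P.right d := fun _ _ => rfl
  { toFun := f
    map_smul' := f.map_smul
    map_zero' := f.map_zero
    map_add' := f.map_add
    map_mul' := fun x y => by
      induction x using TensorProduct.induction_on with
      | zero => simp
      | add x₁ x₂ h₁ h₂ => rw [add_mul, map_add, h₁, h₂, map_add, add_mul]
      | tmul c d =>
        induction y using TensorProduct.induction_on with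
        | zero => simp
        | add y₁ y₂ h₁ h₂ => rw [mul_add, map_add, h₁, h₂, map_add, mul_add]
        | tmul c' d' =>
          rw [Algebra.TensorProduct.tmul_mul_tmul, hf, hf, hf, map_mul, map_mul, mul_assoc,
            mul_assoc, ← mul_assoc (P.left c'), P.comm, mul_assoc]
    map_star' := fun x => by
      induction x using TensorProduct.induction_on with
      | zero => simp
      | add x₁ x₂ h₁ h₂ => rw [star_add, map_add, h₁, h₂, map_add, star_add]
      | tmul c d =>
        rw [TensorProduct.star_tmul, hf, hf, star_mul, map_star, map_star, ← map_star,
          ← map_star, P.comm] }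

theorem CommutingPair.hom_tmul {C : Type u} {D : Type v} {E : Type w} [NonUnitalCStarAlgebra C]
    [NonUnitalCStarAlgebra D] [NonUnitalCStarAlgebra E] (P : CommutingPair C D E) (c : C) (d : D) :
    P.hom (c ⊗ₜ d) = P.left c * P.right d := rfl

variable (C : Type u) (D : Type v) [NonUnitalCStarAlgebra C] [NonUnitalCStarAlgebra D]

theorem bddAbove_maxSeminorm (x : C ⊗[ℂ] D) :
    BddAbove {r : ℝ | ∃ q ∈ {q : CStarSeminorm (C ⊗[ℂ] D) |
      ∃ (E : Type (max u v)) (_ : NonUnitalCStarAlgebra E) (P : CommutingPair C D E),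
        q = CStarSeminorm.ofHom P.hom}, r = q.toSeminorm x} := by
  suffices h : ∃ B : ℝ, ∀ (E : Type (max u v)) (_ : NonUnitalCStarAlgebra E)
      (P : CommutingPair C D E), ‖P.hom x‖ ≤ B by
    obtain ⟨B, hB⟩ := h
    refine ⟨B, ?_⟩
    rintro r ⟨q, ⟨E, _, P, rfl⟩, rfl⟩
    exact hB E _ P
  induction x using TensorProduct.induction_on with
  | zero => exact ⟨0, fun E _ P => by simp⟩
  | add x y hx hy =>
    obtain ⟨B₁, h₁⟩ := hx
    obtain ⟨B₂, h₂⟩ := hy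
    refine ⟨B₁ + B₂, fun E _ P => ?_⟩
    rw [map_add]
    exact (norm_add_le _ _).trans (add_le_add (h₁ E _ P) (h₂ E _ P))
  | tmul c d =>
    refine ⟨‖c‖ * ‖d‖, fun E _ P => ?_⟩
    rw [CommutingPair.hom_tmul]
    exact (norm_mul_le _ _).trans (mul_le_mul (NonUnitalStarAlgHom.norm_apply_le P.left c)
      (NonUnitalStarAlgHom.norm_apply_le P.right d) (norm_nonneg _) (norm_nonneg _))

/-- The maximal `C*`-norm on the algebraic tensor product `C ⊙ D`: the supremum of
`‖∑ φ(cᵢ) ψ(dᵢ)‖` over all pairs `(φ, ψ)` of `*`-homomorphisms into a `C*`-algebra with commuting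
ranges. -/
def maxSeminorm : CStarSeminorm (C ⊗[ℂ] D) :=
  CStarSeminorm.sup {q | ∃ (E : Type (max u v)) (_ : NonUnitalCStarAlgebra E)
    (P : CommutingPair C D E), q = CStarSeminorm.ofHom P.hom} (bddAbove_maxSeminorm C D)

/-- The maximal tensor product of two `C*`-algebras. If one of them is commutative, it is nuclear,
so this is the completion in the only `C*`-norm on the algebraic tensor product. -/
def CStarTensor : Type (max u v) := CStarCompletion (maxSeminorm C D)

instance : NonUnitalCStarAlgebra (CStarTensor C D) :=
  inferInstanceAs (NonUnitalCStarAlgebra (CStarCompletion (maxSeminorm C D)))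

variable {C D}

/-- The elementary tensor `c ⊗ d`. -/
def CStarTensor.tmul (c : C) (d : D) : CStarTensor C D :=
  CStarCompletion.mk (p := maxSeminorm C D) (c ⊗ₜ d)

/-- The tensor product of two `*`-homomorphisms, on the algebraic tensor products. -/
def algTensorMap {C' : Type u} {D' : Type v} [NonUnitalCStarAlgebra C'] [NonUnitalCStarAlgebra D']
    (φ : C →⋆ₙₐ[ℂ] C') (ψ : D →⋆ₙₐ[ℂ] D') : C ⊗[ℂ] D →⋆ₙₐ[ℂ] C' ⊗[ℂ] D' :=
  let f : C ⊗[ℂ] D →ₗ[ℂ] C' ⊗[ℂ] D' :=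
    TensorProduct.map (φ : C →ₗ[ℂ] C') (ψ : D →ₗ[ℂ] D')
  have hf : ∀ c d, f (c ⊗ₜ d) = φ c ⊗ₜ ψ d := fun _ _ => rfl
  { toFun := f
    map_smul' := f.map_smul
    map_zero' := f.map_zero
    map_add' := f.map_add
    map_mul' := fun x y => by
      induction x using TensorProduct.induction_on with
      | zero => simp
      | add x₁ x₂ h₁ h₂ => rw [add_mul, map_add, h₁, h₂, map_add, add_mul]
      | tmul c d =>
        induction y using TensorProduct.induction_on with
        | zero => simp
        | add y₁ y₂ h₁ h₂ => rw [mul_add, map_add, h₁, h₂, map_add, mul_add]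
        | tmul c' d' =>
          rw [Algebra.TensorProduct.tmul_mul_tmul, hf, hf, hf, map_mul, map_mul,
            Algebra.TensorProduct.tmul_mul_tmul]
    map_star' := fun x => by
      change f (star x) = star (f x)
      induction x using TensorProduct.induction_on with
      | zero => simp
      | add x₁ x₂ h₁ h₂ => rw [star_add, map_add, h₁, h₂, map_add, star_add]
      | tmul c d =>
        rw [TensorProduct.star_tmul, hf, hf, TensorProduct.star_tmul, map_star, map_star] }

theorem algTensorMap_tmul {C' : Type u} {D' : Type v} [NonUnitalCStarAlgebra C']
    [NonUnitalCStarAlgebra D'] (φ : C →⋆ₙₐ[ℂ] C') (ψ : D →⋆ₙₐ[ℂ] D') (c : C) (d : D) :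
    algTensorMap φ ψ (c ⊗ₜ d) = φ c ⊗ₜ ψ d := rfl

theorem maxSeminorm_algTensorMap_le {C' : Type u} {D' : Type v} [NonUnitalCStarAlgebra C']
    [NonUnitalCStarAlgebra D'] (φ : C →⋆ₙₐ[ℂ] C') (ψ : D →⋆ₙₐ[ℂ] D') (x : C ⊗[ℂ] D) :
    (maxSeminorm C' D').toSeminorm (algTensorMap φ ψ x) ≤ (maxSeminorm C D).toSeminorm x := by
  refine CStarSeminorm.sup_le (apply_nonneg _ _) ?_
  rintro q ⟨E, _, P, rfl⟩
  let Q : CommutingPair C D E := ⟨P.left.comp φ, P.right.comp ψ, fun c d => P.comm _ _⟩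
  have h : ∀ x, P.hom (algTensorMap φ ψ x) = Q.hom x := fun x => by
    induction x using TensorProduct.induction_on with
    | zero => simp
    | add x₁ x₂ h₁ h₂ => rw [map_add, map_add, h₁, h₂, map_add]
    | tmul c d => rfl
  change ‖P.hom (algTensorMap φ ψ x)‖ ≤ _
  rw [h]
  refine CStarSeminorm.le_sup (q := CStarSeminorm.ofHom Q.hom) ?_ x
  exact ⟨E, _, Q, rfl⟩

/-- The tensor product `φ ⊗ ψ` of two `*`-homomorphisms. -/
def tensorMap {C' : Type u} {D' : Type v} [NonUnitalCStarAlgebra C'] [NonUnitalCStarAlgebra D']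
    (φ : C →⋆ₙₐ[ℂ] C') (ψ : D →⋆ₙₐ[ℂ] D') : CStarTensor C D →⋆ₙₐ[ℂ] CStarTensor C' D' :=
  (CStarCompletion.map (algTensorMap φ ψ) (maxSeminorm_algTensorMap_le φ ψ) :
    CStarCompletion (maxSeminorm C D) →⋆ₙₐ[ℂ] CStarCompletion (maxSeminorm C' D'))

theorem tensorMap_tmul {C' : Type u} {D' : Type v} [NonUnitalCStarAlgebra C']
    [NonUnitalCStarAlgebra D'] (φ : C →⋆ₙₐ[ℂ] C') (ψ : D →⋆ₙₐ[ℂ] D') (c : C) (d : D) :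
    tensorMap φ ψ (CStarTensor.tmul c d) = CStarTensor.tmul (φ c) (ψ d) :=
  CStarCompletion.map_mk (algTensorMap φ ψ) (maxSeminorm_algTensorMap_le φ ψ) (c ⊗ₜ d)

theorem continuous_tensorMap {C' : Type u} {D' : Type v} [NonUnitalCStarAlgebra C']
    [NonUnitalCStarAlgebra D'] (φ : C →⋆ₙₐ[ℂ] C') (ψ : D →⋆ₙₐ[ℂ] D') :
    Continuous (tensorMap φ ψ) := CStarCompletion.continuous_map (algTensorMap φ ψ) (maxSeminorm_algTensorMap_le φ ψ)

theorem CStarTensor.hom_ext {F : Type*} [NonUnitalCStarAlgebra F]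
    {f g : CStarTensor C D →⋆ₙₐ[ℂ] F} (hf : Continuous f) (hg : Continuous g)
    (h : ∀ c d, f (CStarTensor.tmul c d) = g (CStarTensor.tmul c d))
    (x : CStarTensor C D) : f x = g x := by
  refine CStarCompletion.induction_on (p := maxSeminorm C D) (P := fun x => f x = g x) x
    (isClosed_eq hf hg) fun x => ?_
  induction x using TensorProduct.induction_on with
  | zero => exact (map_zero f).trans (map_zero g).symm
  | add x₁ x₂ h₁ h₂ =>
    rw [CStarCompletion.mk_add]
    exact (map_add f _ _).trans ((congrArg₂ (· + ·) h₁ h₂).trans (map_add g _ _).symm)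
  | tmul c d => exact h c d

/-- The tensor product `σ ⊗ ρ` of two actions of a group by automorphisms. -/
def tensorAction {G : Type*} [Group G] (σ : G →* (C ≃⋆ₐ[ℂ] C)) (ρ : G →* (D ≃⋆ₐ[ℂ] D)) :
    G →* (CStarTensor C D ≃⋆ₐ[ℂ] CStarTensor C D) :=
  let t : G → CStarTensor C D →⋆ₙₐ[ℂ] CStarTensor C D := fun g =>
    tensorMap (σ g : C →⋆ₙₐ[ℂ] C) (ρ g : D →⋆ₙₐ[ℂ] D)
  have tc : ∀ g, Continuous (t g) := fun g => continuous_tensorMap _ _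
  have tmk : ∀ g c d, t g (CStarTensor.tmul c d) =
      CStarTensor.tmul (σ g c) (ρ g d) := fun g c d => tensorMap_tmul _ _ c d
  have one : ∀ x, t 1 x = x := fun x =>
    CStarTensor.hom_ext (f := t 1) (g := NonUnitalStarAlgHom.id ℂ _) (tc 1) continuous_id
      (fun c d => by rw [tmk, map_one, map_one]; rfl) x
  have mul : ∀ g h x, t (g * h) x = t g (t h x) := fun g h x =>
    CStarTensor.hom_ext (f := t (g * h)) (g := (t g).comp (t h)) (tc _) ((tc g).comp (tc h))
      (fun c d => by
        rw [NonUnitalStarAlgHom.comp_apply, tmk, tmk, tmk, map_mul, map_mul]; rfl) x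
  { toFun := fun g =>
      { toFun := t g
        invFun := t g⁻¹
        left_inv := fun x => by rw [← mul, inv_mul_cancel, one]
        right_inv := fun x => by rw [← mul, mul_inv_cancel, one]
        map_mul' := map_mul (t g)
        map_add' := map_add (t g)
        map_star' := map_star (t g)
        map_smul' := map_smul (t g) }
    map_one' := StarAlgEquiv.ext one
    map_mul' := fun g h => StarAlgEquiv.ext (mul g h) }

theorem tensorAction_tmul {G : Type*} [Group G] (σ : G →* (C ≃⋆ₐ[ℂ] C)) (ρ : G →* (D ≃⋆ₐ[ℂ] D))
    (g : G) (c : C) (d : D) :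
    tensorAction σ ρ g (CStarTensor.tmul c d) = CStarTensor.tmul (σ g c) (ρ g d) :=
  tensorMap_tmul (σ g : C →⋆ₙₐ[ℂ] C) (ρ g : D →⋆ₙₐ[ℂ] D) c d

theorem tensorMap_tensorAction {G : Type*} [Group G] {C' : Type u} [NonUnitalCStarAlgebra C']
    (σ : G →* (C ≃⋆ₐ[ℂ] C)) (σ' : G →* (C' ≃⋆ₐ[ℂ] C')) (ρ : G →* (D ≃⋆ₐ[ℂ] D))
    (φ : C →⋆ₙₐ[ℂ] C') (hφ : ∀ g c, φ (σ g c) = σ' g (φ c)) (g : G) (x : CStarTensor C D) :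
    tensorMap φ (NonUnitalStarAlgHom.id ℂ D) (tensorAction σ ρ g x) =
      tensorAction σ' ρ g (tensorMap φ (NonUnitalStarAlgHom.id ℂ D) x) := by
  let t := tensorMap (σ g : C →⋆ₙₐ[ℂ] C) (ρ g : D →⋆ₙₐ[ℂ] D)
  let t' := tensorMap (σ' g : C' →⋆ₙₐ[ℂ] C') (ρ g : D →⋆ₙₐ[ℂ] D)
  let m := tensorMap φ (NonUnitalStarAlgHom.id ℂ D)
  have ht : Continuous t := continuous_tensorMap _ _
  have ht' : Continuous t' := continuous_tensorMap _ _
  have hm : Continuous m := continuous_tensorMap _ _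
  refine CStarTensor.hom_ext (f := m.comp t) (g := t'.comp m) (hm.comp ht) (ht'.comp hm)
    (fun c d => ?_) x
  rw [NonUnitalStarAlgHom.comp_apply, NonUnitalStarAlgHom.comp_apply, tensorMap_tmul,
    tensorMap_tmul, tensorMap_tmul, tensorMap_tmul]
  exact congrArg₂ CStarTensor.tmul (hφ g c) rfl

end Tensor

/-! ### The crossed product by a discrete group -/

section Crossed

variable {G : Type v} {D : Type w} [Group G] [NonUnitalCStarAlgebra D]

/-- The `*`-algebra `C_c(G, D)` of finitely supported functions, with the convolution product and
the involution given by the action `σ`; `Finsupp.single s a` is the element `a δ_s`. -/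
def CcAlg (_σ : G →* (D ≃⋆ₐ[ℂ] D)) : Type (max v w) := G →₀ D

namespace CcAlg

variable (σ : G →* (D ≃⋆ₐ[ℂ] D))

instance : AddCommGroup (CcAlg σ) := inferInstanceAs (AddCommGroup (G →₀ D))
instance : Module ℂ (CcAlg σ) := inferInstanceAs (Module ℂ (G →₀ D))

/-- The element `a δ_s`. -/
def single (s : G) (a : D) : CcAlg σ := Finsupp.single s a

variable {σ}

theorem single_add (s : G) (a b : D) : single σ s (a + b) = single σ s a + single σ s b :=
  Finsupp.single_add s a b
theorem single_zero (s : G) : single σ s 0 = 0 := Finsupp.single_zero s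
theorem smul_single (c : ℂ) (s : G) (a : D) : c • single σ s a = single σ s (c • a) :=
  Finsupp.smul_single c s a

@[elab_as_elim]
theorem induction {P : CcAlg σ → Prop} (f : CcAlg σ) (zero : P 0)
    (add : ∀ f g, P f → P g → P (f + g)) (single : ∀ s a, P (single σ s a)) : P f :=
  Finsupp.induction_linear f zero add single

/-- The additive extension of a map defined on the elements `a δ_s`. -/
def lift {M : Type*} [AddCommMonoid M] (φ : G → D →+ M) : CcAlg σ →+ M :=
  Finsupp.liftAddHom φ

theorem lift_single {M : Type*} [AddCommMonoid M] (φ : G → D →+ M) (s : G) (a : D) :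
    lift φ (single σ s a) = φ s a :=
  Finsupp.liftAddHom_apply_single φ s a

theorem lift_apply {M : Type*} [AddCommMonoid M] (φ : G → D →+ M) (f : CcAlg σ) :
    lift φ f = Finsupp.sum (show G →₀ D from f) fun s a => φ s a := rfl

/-- `(a δ_s) * f` for `f ∈ C_c(G, D)`. -/
def mulSingle (s : G) (a : D) : CcAlg σ →+ CcAlg σ :=
  lift fun t =>
    { toFun := fun b => single σ (s * t) (a * σ s b)
      map_zero' := by rw [map_zero, mul_zero, single_zero]
      map_add' := fun b c => by rw [map_add, mul_add, single_add] }

theorem mulSingle_single (s t : G) (a b : D) :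
    mulSingle s a (single σ t b) = single σ (s * t) (a * σ s b) := lift_single _ _ _

/-- The convolution product, `(a δ_s) * (b δ_t) = a σ_s(b) δ_{st}`. -/
def mulHom : CcAlg σ →+ CcAlg σ →+ CcAlg σ :=
  lift fun s =>
    { toFun := fun a => mulSingle s a
      map_zero' := by
        ext f
        induction f using induction with
        | zero => simp
        | add f g hf hg => rw [map_add, hf, hg, map_add]
        | single t b => rw [mulSingle_single, zero_mul, single_zero]; rfl
      map_add' := fun a a' => by
        ext f
        induction f using induction with
        | zero => simp
        | add f g hf hg => rw [map_add, hf, hg, map_add]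
        | single t b =>
          rw [AddMonoidHom.add_apply, mulSingle_single, mulSingle_single, mulSingle_single,
            add_mul, single_add] }

/-- The involution, `(a δ_s)* = σ_{s⁻¹}(a*) δ_{s⁻¹}`. -/
def starHom : CcAlg σ →+ CcAlg σ :=
  lift fun s =>
    { toFun := fun a => single σ s⁻¹ (σ s⁻¹ (star a))
      map_zero' := by rw [star_zero, map_zero, single_zero]
      map_add' := fun b c => by rw [star_add, map_add, single_add] }

instance : Mul (CcAlg σ) := ⟨fun f g => mulHom f g⟩
instance : Star (CcAlg σ) := ⟨fun f => starHom f⟩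

theorem single_mul_single (s t : G) (a b : D) :
    single σ s a * single σ t b = single σ (s * t) (a * σ s b) := by
  change mulHom (single σ s a) (single σ t b) = _
  rw [mulHom, lift_single]
  exact mulSingle_single s t a b

theorem star_single (s : G) (a : D) :
    star (single σ s a) = single σ s⁻¹ (σ s⁻¹ (star a)) := lift_single _ _ _

theorem mul_add' (f g h : CcAlg σ) : f * (g + h) = f * g + f * h := map_add (mulHom f) g h
theorem add_mul' (f g h : CcAlg σ) : (f + g) * h = f * h + g * h := by
  change mulHom (f + g) h = mulHom f h + mulHom g h
  rw [map_add]; rfl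
theorem zero_mul' (f : CcAlg σ) : 0 * f = 0 := by
  change mulHom 0 f = 0
  rw [map_zero]; rfl
theorem mul_zero' (f : CcAlg σ) : f * 0 = 0 := map_zero (mulHom f)
theorem star_add' (f g : CcAlg σ) : star (f + g) = star f + star g := map_add starHom f g
theorem star_zero' : star (0 : CcAlg σ) = 0 := map_zero starHom

instance : NonUnitalRing (CcAlg σ) where
  left_distrib := mul_add'
  right_distrib := add_mul'
  zero_mul := zero_mul'
  mul_zero := mul_zero'
  mul_assoc f g h := by
    induction f using induction with
    | zero => simp only [zero_mul']
    | add f f' hf hf' => simp only [add_mul', hf, hf']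
    | single s a =>
      induction g using induction with
      | zero => simp only [zero_mul', mul_zero']
      | add f f' hf hf' => simp only [add_mul', mul_add', hf, hf']
      | single t b =>
        induction h using induction with
        | zero => simp only [mul_zero']
        | add f f' hf hf' => simp only [mul_add', hf, hf']
        | single r c =>
          simp only [single_mul_single, mul_assoc, map_mul, StarAlgEquiv.mul_apply]

theorem apply_inv_apply (s : G) (a : D) : σ s (σ s⁻¹ a) = a := by
  rw [← StarAlgEquiv.mul_apply, ← map_mul, mul_inv_cancel, map_one]; rfl

theorem inv_apply_apply (s : G) (a : D) : σ s⁻¹ (σ s a) = a := by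
  rw [← StarAlgEquiv.mul_apply, ← map_mul, inv_mul_cancel, map_one]; rfl

instance : StarRing (CcAlg σ) where
  star_involutive f := by
    induction f using induction with
    | zero => simp only [star_zero']
    | add f g hf hg => simp only [star_add', hf, hg]
    | single s a => rw [star_single, star_single, ← map_star, star_star, inv_inv, apply_inv_apply]
  star_add := star_add'
  star_mul f g := by
    induction f using induction with
    | zero => simp only [zero_mul', mul_zero', star_zero']
    | add f f' hf hf' => simp only [add_mul', mul_add', star_add', hf, hf']
    | single s a =>
      induction g using induction with
      | zero => simp only [zero_mul', mul_zero', star_zero']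
      | add f f' hf hf' => simp only [add_mul', mul_add', star_add', hf, hf']
      | single t b =>
        simp only [star_single, single_mul_single, mul_inv_rev, star_mul, map_mul,
          StarAlgEquiv.mul_apply, ← map_star, inv_apply_apply]

instance : StarModule ℂ (CcAlg σ) where
  star_smul c f := by
    induction f using induction with
    | zero => simp only [smul_zero, star_zero']
    | add f g hf hg => simp only [smul_add, star_add', hf, hg]
    | single s a => simp only [smul_single, star_single, star_smul, map_smul]

instance : IsScalarTower ℂ (CcAlg σ) (CcAlg σ) where
  smul_assoc c f g := by
    change (c • f) * g = c • (f * g)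
    induction f using induction with
    | zero => simp only [smul_zero, zero_mul']
    | add f f' hf hf' => simp only [smul_add, add_mul', hf, hf']
    | single s a =>
      induction g using induction with
      | zero => simp only [smul_zero, mul_zero']
      | add f f' hf hf' => simp only [smul_add, mul_add', hf, hf']
      | single t b => simp only [smul_single, single_mul_single, smul_mul_assoc]

instance : SMulCommClass ℂ (CcAlg σ) (CcAlg σ) where
  smul_comm c f g := by
    change c • (f * g) = f * (c • g)
    induction f using induction with
    | zero => simp only [smul_zero, zero_mul']
    | add f f' hf hf' => simp only [smul_add, add_mul', hf, hf']
    | single s a =>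
      induction g using induction with
      | zero => simp only [smul_zero, mul_zero']
      | add f f' hf hf' => simp only [smul_add, mul_add', hf, hf']
      | single t b => simp only [smul_single, single_mul_single, map_smul, mul_smul_comm]

end CcAlg

/-- A covariant representation `(π, U)` of the dynamical system `(D, G, σ)` on a Hilbert space:
a (possibly degenerate) `*`-representation `π` of `D` and a unitary representation `U` of `G` with
`π(σ_g(d)) = U_g π(d) U_g*`. -/
structure CovariantRep (σ : G →* (D ≃⋆ₐ[ℂ] D)) (H : Type*) [NormedAddCommGroup H]
    [InnerProductSpace ℂ H] [CompleteSpace H] where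
  rep : D →⋆ₙₐ[ℂ] (H →L[ℂ] H)
  U : G →* unitary (H →L[ℂ] H)
  covariant : ∀ g d, rep (σ g d) = (U g : H →L[ℂ] H) * rep d * star (U g : H →L[ℂ] H)

namespace CovariantRep

variable {σ : G →* (D ≃⋆ₐ[ℂ] D)} {H : Type*} [NormedAddCommGroup H]
    [InnerProductSpace ℂ H] [CompleteSpace H] (ρ : CovariantRep σ H)

theorem U_mul_rep (g : G) (d : D) :
    (ρ.U g : H →L[ℂ] H) * ρ.rep d = ρ.rep (σ g d) * (ρ.U g : H →L[ℂ] H) := by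
  rw [ρ.covariant, mul_assoc, Unitary.coe_star_mul_self, mul_one]

/-- The linear map `∑ a_s δ_s ↦ ∑ π(a_s) U_s`. -/
def integratedAdd : CcAlg σ →+ (H →L[ℂ] H) :=
  CcAlg.lift fun s =>
    { toFun := fun a => ρ.rep a * (ρ.U s : H →L[ℂ] H)
      map_zero' := by rw [map_zero, zero_mul]
      map_add' := fun a b => by rw [map_add, add_mul] }

theorem integratedAdd_single (s : G) (a : D) :
    ρ.integratedAdd (CcAlg.single σ s a) = ρ.rep a * (ρ.U s : H →L[ℂ] H) :=
  CcAlg.lift_single _ _ _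

/-- The integrated form `π × U` of a covariant representation, `∑ a_s δ_s ↦ ∑ π(a_s) U_s`. -/
def integrated : CcAlg σ →⋆ₙₐ[ℂ] (H →L[ℂ] H) where
  toFun := ρ.integratedAdd
  map_smul' c f := by
    change ρ.integratedAdd (c • f) = c • ρ.integratedAdd f
    induction f using CcAlg.induction with
    | zero => simp
    | add f g hf hg => rw [smul_add, map_add, hf, hg, map_add, smul_add]
    | single s a =>
      rw [CcAlg.smul_single, integratedAdd_single, integratedAdd_single, map_smul, smul_mul_assoc]
  map_zero' := map_zero _
  map_add' := map_add _
  map_mul' f g := by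
    induction f using CcAlg.induction with
    | zero => simp
    | add f f' hf hf' => rw [add_mul, map_add, hf, hf', map_add, add_mul]
    | single s a =>
      induction g using CcAlg.induction with
      | zero => simp
      | add f f' hf hf' => rw [mul_add, map_add, hf, hf', map_add, mul_add]
      | single t b =>
        rw [CcAlg.single_mul_single, integratedAdd_single, integratedAdd_single,
          integratedAdd_single, map_mul, map_mul, Submonoid.coe_mul, mul_assoc, mul_assoc,
          ← mul_assoc (ρ.rep (σ s b)), ← U_mul_rep, mul_assoc]
  map_star' f := by
    induction f using CcAlg.induction with
    | zero => simp
    | add f f' hf hf' => rw [star_add, map_add, hf, hf', map_add, star_add]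
    | single s a =>
      have h : star (ρ.U s : H →L[ℂ] H) = (ρ.U s⁻¹ : H →L[ℂ] H) := by
        rw [map_inv]; rfl
      rw [CcAlg.star_single, integratedAdd_single, integratedAdd_single, star_mul, h, ← U_mul_rep,
        map_star]

theorem integrated_single (s : G) (a : D) :
    ρ.integrated (CcAlg.single σ s a) = ρ.rep a * (ρ.U s : H →L[ℂ] H) :=
  ρ.integratedAdd_single s a

end CovariantRep

variable (σ : G →* (D ≃⋆ₐ[ℂ] D))

theorem bddAbove_crossedSeminorm (f : CcAlg σ) :
    BddAbove {r : ℝ | ∃ q ∈ {q : CStarSeminorm (CcAlg σ) |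
      ∃ (H : Type (max v w)) (_ : NormedAddCommGroup H) (_ : InnerProductSpace ℂ H)
        (_ : CompleteSpace H) (ρ : CovariantRep σ H), q = CStarSeminorm.ofHom ρ.integrated},
      r = q.toSeminorm f} := by
  suffices h : ∃ B : ℝ, ∀ (H : Type (max v w)) (_ : NormedAddCommGroup H)
      (_ : InnerProductSpace ℂ H) (_ : CompleteSpace H) (ρ : CovariantRep σ H),
      ‖ρ.integrated f‖ ≤ B by
    obtain ⟨B, hB⟩ := h
    refine ⟨B, ?_⟩
    rintro r ⟨q, ⟨H, _, _, _, ρ, rfl⟩, rfl⟩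
    exact hB H _ _ _ ρ
  induction f using CcAlg.induction with
  | zero => exact ⟨0, fun H _ _ _ ρ => by simp⟩
  | add f g hf hg =>
    obtain ⟨B₁, h₁⟩ := hf
    obtain ⟨B₂, h₂⟩ := hg
    refine ⟨B₁ + B₂, fun H _ _ _ ρ => ?_⟩
    rw [map_add]
    exact (norm_add_le _ _).trans (add_le_add (h₁ H _ _ _ ρ) (h₂ H _ _ _ ρ))
  | single s a =>
    refine ⟨‖a‖, fun H _ _ _ ρ => ?_⟩
    rw [CovariantRep.integrated_single, CStarRing.norm_mul_coe_unitary]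
    exact NonUnitalStarAlgHom.norm_apply_le ρ.rep a

/-- The universal norm `‖f‖ = sup ‖(π × U)(f)‖` on `C_c(G, D)`, the supremum being taken over all
covariant representations `(π, U)` on Hilbert spaces. -/
def crossedSeminorm : CStarSeminorm (CcAlg σ) :=
  CStarSeminorm.sup {q | ∃ (H : Type (max v w)) (_ : NormedAddCommGroup H)
    (_ : InnerProductSpace ℂ H) (_ : CompleteSpace H) (ρ : CovariantRep σ H),
      q = CStarSeminorm.ofHom ρ.integrated} (bddAbove_crossedSeminorm σ)

/-- The (full) crossed product `D ×_σ G`. -/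
def CrossedProduct : Type (max v w) := CStarCompletion (crossedSeminorm σ)

instance : NonUnitalCStarAlgebra (CrossedProduct σ) :=
  inferInstanceAs (NonUnitalCStarAlgebra (CStarCompletion (crossedSeminorm σ)))

variable {σ}

theorem le_crossedSeminorm {H : Type (max v w)} [NormedAddCommGroup H] [InnerProductSpace ℂ H]
    [CompleteSpace H] (ρ : CovariantRep σ H) (f : CcAlg σ) :
    ‖ρ.integrated f‖ ≤ (crossedSeminorm σ).toSeminorm f := by
  refine CStarSeminorm.le_sup (q := CStarSeminorm.ofHom ρ.integrated) ?_ f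
  exact ⟨H, _, _, _, ρ, rfl⟩

theorem crossedSeminorm_le {f : CcAlg σ} {c : ℝ} (hc : 0 ≤ c)
    (h : ∀ (H : Type (max v w)) (_ : NormedAddCommGroup H) (_ : InnerProductSpace ℂ H)
      (_ : CompleteSpace H) (ρ : CovariantRep σ H), ‖ρ.integrated f‖ ≤ c) :
    (crossedSeminorm σ).toSeminorm f ≤ c := by
  refine CStarSeminorm.sup_le hc ?_
  rintro q ⟨H, _, _, _, ρ, rfl⟩
  exact h H _ _ _ ρ

variable (σ)

/-- The canonical map of `C_c(G, D)` into the crossed product. -/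
def crossedMk : CcAlg σ →⋆ₙₐ[ℂ] CrossedProduct σ := CStarCompletion.mkHom (crossedSeminorm σ)

variable {σ} in
theorem crossed_induction_on {P : CrossedProduct σ → Prop} (x : CrossedProduct σ)
    (hp : IsClosed {x | P x}) (ih : ∀ f, P (crossedMk σ f)) : P x :=
  CStarCompletion.induction_on (p := crossedSeminorm σ) x hp ih

/-- The canonical homomorphism `j_D : D → D ×_σ G`. -/
def crossedIncl : D →⋆ₙₐ[ℂ] CrossedProduct σ where
  toFun d := crossedMk σ (CcAlg.single σ 1 d)
  map_smul' c d := by rw [← CcAlg.smul_single, map_smul]; rfl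
  map_zero' := by rw [CcAlg.single_zero, map_zero]
  map_add' a b := by rw [CcAlg.single_add, map_add]
  map_mul' a b := by
    rw [← map_mul, CcAlg.single_mul_single, map_one, mul_one]; rfl
  map_star' a := by
    rw [← map_star, CcAlg.star_single, inv_one, map_one]; rfl

/-- Left multiplication by `δ_g` on `C_c(G, D)`: `b δ_t ↦ σ_g(b) δ_{gt}`. -/
def leftDelta (g : G) : CcAlg σ →ₗ[ℂ] CcAlg σ :=
  let f : CcAlg σ →+ CcAlg σ := CcAlg.lift fun t =>
    { toFun := fun b => CcAlg.single σ (g * t) (σ g b)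
      map_zero' := by rw [map_zero, CcAlg.single_zero]
      map_add' := fun a b => by rw [map_add, CcAlg.single_add] }
  { toFun := f
    map_add' := map_add f
    map_smul' := fun c x => by
      induction x using CcAlg.induction with
      | zero => simp
      | add x y hx hy => rw [smul_add, map_add, hx, hy, map_add, smul_add]
      | single t b =>
        simp only [f, CcAlg.smul_single, CcAlg.lift_single, AddMonoidHom.coe_mk, ZeroHom.coe_mk,
          map_smul, RingHom.id_apply] }

/-- Right multiplication by `δ_g` on `C_c(G, D)`: `a δ_s ↦ a δ_{sg}`. -/
def rightDelta (g : G) : CcAlg σ →ₗ[ℂ] CcAlg σ :=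
  let f : CcAlg σ →+ CcAlg σ := CcAlg.lift fun s =>
    { toFun := fun a => CcAlg.single σ (s * g) a
      map_zero' := by rw [CcAlg.single_zero]
      map_add' := fun a b => by rw [CcAlg.single_add] }
  { toFun := f
    map_add' := map_add f
    map_smul' := fun c x => by
      induction x using CcAlg.induction with
      | zero => simp
      | add x y hx hy => rw [smul_add, map_add, hx, hy, map_add, smul_add]
      | single t b =>
        simp only [f, CcAlg.smul_single, CcAlg.lift_single, AddMonoidHom.coe_mk, ZeroHom.coe_mk,
          RingHom.id_apply] }

variable {σ}

theorem leftDelta_single (g t : G) (b : D) :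
    leftDelta σ g (CcAlg.single σ t b) = CcAlg.single σ (g * t) (σ g b) :=
  CcAlg.lift_single _ _ _

theorem rightDelta_single (g s : G) (a : D) :
    rightDelta σ g (CcAlg.single σ s a) = CcAlg.single σ (s * g) a :=
  CcAlg.lift_single _ _ _

theorem crossedSeminorm_leftDelta_le (g : G) (f : CcAlg σ) :
    (crossedSeminorm σ).toSeminorm (leftDelta σ g f) ≤ (crossedSeminorm σ).toSeminorm f := by
  refine crossedSeminorm_le (apply_nonneg _ _) fun H _ _ _ ρ => ?_
  have h : ∀ f, ρ.integrated (leftDelta σ g f) = (ρ.U g : H →L[ℂ] H) * ρ.integrated f := by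
    intro f
    induction f using CcAlg.induction with
    | zero => simp
    | add x y hx hy => rw [map_add, map_add, hx, hy, map_add, mul_add]
    | single t b =>
      rw [leftDelta_single, CovariantRep.integrated_single, CovariantRep.integrated_single,
        ← mul_assoc, ρ.U_mul_rep, map_mul, Submonoid.coe_mul, mul_assoc]
  rw [h, CStarRing.norm_coe_unitary_mul]
  exact le_crossedSeminorm ρ f

theorem crossedSeminorm_rightDelta_le (g : G) (f : CcAlg σ) :
    (crossedSeminorm σ).toSeminorm (rightDelta σ g f) ≤ (crossedSeminorm σ).toSeminorm f := by
  refine crossedSeminorm_le (apply_nonneg _ _) fun H _ _ _ ρ => ?_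
  have h : ∀ f, ρ.integrated (rightDelta σ g f) = ρ.integrated f * (ρ.U g : H →L[ℂ] H) := by
    intro f
    induction f using CcAlg.induction with
    | zero => simp
    | add x y hx hy => rw [map_add, map_add, hx, hy, map_add, add_mul]
    | single t b =>
      rw [rightDelta_single, CovariantRep.integrated_single, CovariantRep.integrated_single,
        map_mul, Submonoid.coe_mul, mul_assoc]
  rw [h, CStarRing.norm_mul_coe_unitary]
  exact le_crossedSeminorm ρ f

theorem rightDelta_mul (g : G) (f h : CcAlg σ) :
    rightDelta σ g f * h = f * leftDelta σ g h := by
  induction f using CcAlg.induction with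
  | zero => simp
  | add x y hx hy => rw [map_add, add_mul, hx, hy, add_mul]
  | single s a =>
    induction h using CcAlg.induction with
    | zero => simp
    | add x y hx hy => rw [map_add, mul_add, hx, hy, mul_add]
    | single t b =>
      rw [rightDelta_single, leftDelta_single, CcAlg.single_mul_single, CcAlg.single_mul_single,
        mul_assoc, map_mul, StarAlgEquiv.mul_apply]

variable (σ)

/-- The canonical homomorphism `j_G` of `G` into the multiplier algebra of `D ×_σ G`. -/
def crossedGroup : G →* 𝓜(ℂ, CrossedProduct σ) :=
  let L : G → CrossedProduct σ →L[ℂ] CrossedProduct σ := fun g =>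
    (CStarCompletion.mapL (leftDelta σ g) (crossedSeminorm_leftDelta_le g) :
      CStarCompletion (crossedSeminorm σ) →L[ℂ] CStarCompletion (crossedSeminorm σ))
  let R : G → CrossedProduct σ →L[ℂ] CrossedProduct σ := fun g =>
    (CStarCompletion.mapL (rightDelta σ g) (crossedSeminorm_rightDelta_le g) :
      CStarCompletion (crossedSeminorm σ) →L[ℂ] CStarCompletion (crossedSeminorm σ))
  have hL : ∀ g f, L g (crossedMk σ f) = crossedMk σ (leftDelta σ g f) :=
    fun g f => CStarCompletion.mapL_mk (leftDelta σ g) (crossedSeminorm_leftDelta_le g) f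
  have hR : ∀ g f, R g (crossedMk σ f) = crossedMk σ (rightDelta σ g f) :=
    fun g f => CStarCompletion.mapL_mk (rightDelta σ g) (crossedSeminorm_rightDelta_le g) f
  have leftMul : ∀ (g h : G) (f : CcAlg σ),
      leftDelta σ (g * h) f = leftDelta σ g (leftDelta σ h f) := fun g h f => by
    induction f using CcAlg.induction with
    | zero => simp
    | add x y hx hy => simp only [map_add, hx, hy]
    | single t b => simp only [leftDelta_single, mul_assoc, map_mul, StarAlgEquiv.mul_apply]
  have rightMul : ∀ (g h : G) (f : CcAlg σ),
      rightDelta σ (g * h) f = rightDelta σ h (rightDelta σ g f) := fun g h f => by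
    induction f using CcAlg.induction with
    | zero => simp
    | add x y hx hy => simp only [map_add, hx, hy]
    | single t b => simp only [rightDelta_single, mul_assoc]
  have leftOne : ∀ f : CcAlg σ, leftDelta σ 1 f = f := fun f => by
    induction f using CcAlg.induction with
    | zero => simp
    | add x y hx hy => simp only [map_add, hx, hy]
    | single t b => rw [leftDelta_single, one_mul, map_one, StarAlgEquiv.one_apply]
  have rightOne : ∀ f : CcAlg σ, rightDelta σ 1 f = f := fun f => by
    induction f using CcAlg.induction with
    | zero => simp
    | add x y hx hy => simp only [map_add, hx, hy]
    | single t b => rw [rightDelta_single, mul_one]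
  { toFun := fun g =>
      { fst := L g
        snd := R g
        central := fun x y => by
          refine crossed_induction_on (P := fun x => R g x * y = x * L g y) x
            (isClosed_eq ((R g).continuous.mul continuous_const)
              (continuous_id.mul continuous_const)) fun f => ?_
          refine crossed_induction_on
            (P := fun y => R g (crossedMk σ f) * y = crossedMk σ f * L g y) y
            (isClosed_eq (continuous_const.mul continuous_id)
              (continuous_const.mul (L g).continuous)) fun h => ?_
          rw [hL, hR, ← map_mul, ← map_mul, rightDelta_mul] }
    map_one' := by
      refine DoubleCentralizer.ext _ _ _ _ (Prod.ext ?_ ?_)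
      · refine ContinuousLinearMap.ext fun x => ?_
        change L 1 x = x
        refine crossed_induction_on (P := fun x => L 1 x = x) x (isClosed_eq (L 1).continuous continuous_id) fun x => ?_
        rw [hL, leftOne]
      · refine ContinuousLinearMap.ext fun x => ?_
        change R 1 x = x
        refine crossed_induction_on (P := fun x => R 1 x = x) x (isClosed_eq (R 1).continuous continuous_id) fun x => ?_
        rw [hR, rightOne]
    map_mul' := fun g h => by
      refine DoubleCentralizer.ext _ _ _ _ (Prod.ext ?_ ?_)
      · refine ContinuousLinearMap.ext fun x => ?_
        change L (g * h) x = L g (L h x)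
        refine crossed_induction_on (P := fun x => L (g * h) x = L g (L h x)) x (isClosed_eq (L _).continuous ((L g).continuous.comp (L h).continuous)) fun x => ?_
        rw [hL, hL, hL, leftMul]
      · refine ContinuousLinearMap.ext fun x => ?_
        change R (g * h) x = R h (R g x)
        refine crossed_induction_on (P := fun x => R (g * h) x = R h (R g x)) x (isClosed_eq (R _).continuous ((R h).continuous.comp (R g).continuous)) fun x => ?_
        rw [hR, hR, hR, rightMul] }

variable {σ}

/-- The product `a m` of an element `a` of a `C*`-algebra `E` and a multiplier `m`, as an element
of the ideal `E` of the multiplier algebra. -/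
def mulMultiplier {E : Type*} [NonUnitalCStarAlgebra E] (a : E) (m : 𝓜(ℂ, E)) : E := m.snd a

theorem coe_mulMultiplier {E : Type*} [NonUnitalCStarAlgebra E] (a : E) (m : 𝓜(ℂ, E)) :
    ((mulMultiplier a m : E) : 𝓜(ℂ, E)) = (a : 𝓜(ℂ, E)) * m := by
  refine DoubleCentralizer.ext _ _ _ _ (Prod.ext ?_ ?_)
  · refine ContinuousLinearMap.ext fun x => ?_
    exact m.central a x
  · refine ContinuousLinearMap.ext fun x => ?_
    change x * m.snd a = m.snd (x * a)
    have h : ∀ y, (x * m.snd a) * y = m.snd (x * a) * y := fun y => by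
      rw [m.central, mul_assoc, mul_assoc, m.central]
    have h2 := h (star (x * m.snd a - m.snd (x * a)))
    rw [← sub_eq_zero, ← sub_mul, CStarRing.mul_star_self_eq_zero_iff, sub_eq_zero] at h2
    exact h2

/-- The homomorphism `D ×_σ G → D' ×_σ' G` induced by an equivariant homomorphism `φ : D → D'`:
`j_D(d) j_G(g) ↦ j_D'(φ(d)) j_G(g)`. -/
def crossedMap {D' : Type w} [NonUnitalCStarAlgebra D'] {σ' : G →* (D' ≃⋆ₐ[ℂ] D')}
    (φ : D →⋆ₙₐ[ℂ] D') (hφ : ∀ g d, φ (σ g d) = σ' g (φ d)) :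
    CrossedProduct σ →⋆ₙₐ[ℂ] CrossedProduct σ' :=
  let f : CcAlg σ →+ CcAlg σ' := CcAlg.lift fun s =>
    { toFun := fun a => CcAlg.single σ' s (φ a)
      map_zero' := by rw [map_zero, CcAlg.single_zero]
      map_add' := fun a b => by rw [map_add, CcAlg.single_add] }
  have hf : ∀ s a, f (CcAlg.single σ s a) = CcAlg.single σ' s (φ a) := fun s a =>
    CcAlg.lift_single _ _ _
  let F : CcAlg σ →⋆ₙₐ[ℂ] CcAlg σ' :=
    { toFun := f
      map_smul' := fun c x => by
        change f (c • x) = c • f x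
        induction x using CcAlg.induction with
        | zero => simp
        | add x y hx hy => rw [smul_add, map_add, hx, hy, map_add, smul_add]
        | single s a => rw [CcAlg.smul_single, hf, hf, CcAlg.smul_single, map_smul]
      map_zero' := map_zero f
      map_add' := map_add f
      map_mul' := fun x y => by
        induction x using CcAlg.induction with
        | zero => simp
        | add x x' hx hx' => rw [add_mul, map_add, hx, hx', map_add, add_mul]
        | single s a =>
          induction y using CcAlg.induction with
          | zero => simp
          | add y y' hy hy' => rw [mul_add, map_add, hy, hy', map_add, mul_add]
          | single t b =>
            rw [CcAlg.single_mul_single, hf, hf, hf, CcAlg.single_mul_single, map_mul, hφ]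
      map_star' := fun x => by
        change f (star x) = star (f x)
        induction x using CcAlg.induction with
        | zero => simp
        | add x y hx hy => rw [star_add, map_add, hx, hy, map_add, star_add]
        | single s a =>
          rw [CcAlg.star_single, hf, hf, CcAlg.star_single, hφ, map_star] }
  have hF : ∀ x, (crossedSeminorm σ').toSeminorm (F x) ≤ (crossedSeminorm σ).toSeminorm x := by
    intro x
    refine crossedSeminorm_le (apply_nonneg _ _) fun H _ _ _ ρ => ?_
    let ρ' : CovariantRep σ H := ⟨ρ.rep.comp φ, ρ.U, fun g d => by
      rw [NonUnitalStarAlgHom.comp_apply, hφ, ρ.covariant]; rfl⟩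
    have h : ∀ x, ρ.integrated (F x) = ρ'.integrated x := fun x => by
      change ρ.integrated (f x) = ρ'.integrated x
      induction x using CcAlg.induction with
      | zero => simp
      | add x y hx hy => rw [map_add, map_add, hx, hy, map_add]
      | single s a =>
        rw [hf, CovariantRep.integrated_single, CovariantRep.integrated_single]; rfl
    rw [h]
    exact le_crossedSeminorm ρ' x
  (CStarCompletion.map F hF :
    CStarCompletion (crossedSeminorm σ) →⋆ₙₐ[ℂ] CStarCompletion (crossedSeminorm σ'))

end Crossed

/-! ### Generated `C*`-subalgebras and restricted actions -/

section Subalgebras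

variable {D : Type*} [NonUnitalCStarAlgebra D]

/-- The `C*`-subalgebra of `D` generated by the set `S`. -/
def cstarGen (S : Set D) : NonUnitalStarSubalgebra ℂ D :=
  (NonUnitalStarAlgebra.adjoin ℂ S).topologicalClosure

instance (S : Set D) : IsClosed (cstarGen S : Set D) :=
  NonUnitalStarSubalgebra.isClosed_topologicalClosure _

theorem subset_cstarGen (S : Set D) : S ⊆ cstarGen S := fun _ hx =>
  NonUnitalStarSubalgebra.le_topologicalClosure _ (NonUnitalStarAlgebra.subset_adjoin ℂ S hx)

theorem cstarGen_le {S : Set D} {T : NonUnitalStarSubalgebra ℂ D} (hT : IsClosed (T : Set D))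
    (h : S ⊆ T) : cstarGen S ≤ T :=
  NonUnitalStarSubalgebra.topologicalClosure_minimal _ (NonUnitalStarAlgebra.adjoin_le h) hT

/-- A `*`-homomorphism that maps `S` into a closed `*`-subalgebra maps `C*(S)` into it. -/
theorem map_mem_of_cstarGen {E : Type*} [NonUnitalCStarAlgebra E] {S : Set D}
    {T : NonUnitalStarSubalgebra ℂ E} (hT : IsClosed (T : Set E)) (f : D →⋆ₙₐ[ℂ] E)
    (h : ∀ x ∈ S, f x ∈ T) {x : D} (hx : x ∈ cstarGen S) : f x ∈ T := by
  have hc : Continuous f :=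
    AddMonoidHomClass.continuous_of_bound f 1 fun x => by
      rw [one_mul]; exact NonUnitalStarAlgHom.norm_apply_le f x
  exact cstarGen_le (T := T.comap f) (hT.preimage hc) h hx

/-- The `C*`-subalgebra generated by `S`, as a `C*`-algebra. -/
def CStarGen (S : Set D) : Type _ := cstarGen S

instance (S : Set D) : NonUnitalCStarAlgebra (CStarGen S) :=
  inferInstanceAs (NonUnitalCStarAlgebra (cstarGen S))

/-- The inclusion of `C*(S)` in `C*(T)`, if `S ⊆ C*(T)`. -/
def CStarGen.incl {S T : Set D} (h : S ⊆ cstarGen T) : CStarGen S →⋆ₙₐ[ℂ] CStarGen T :=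
  (NonUnitalStarSubalgebra.inclusion (cstarGen_le inferInstance h) : cstarGen S →⋆ₙₐ[ℂ] cstarGen T)

/-- The restriction of an action on `D` to the `C*`-subalgebra generated by an invariant set. -/
def restrictAction {G : Type*} [Group G] (σ : G →* (D ≃⋆ₐ[ℂ] D)) (S : Set D)
    (hS : ∀ g, ∀ x ∈ S, σ g x ∈ S) : G →* (CStarGen S ≃⋆ₐ[ℂ] CStarGen S) :=
  have h : ∀ g, ∀ x ∈ cstarGen S, σ g x ∈ cstarGen S := fun g x hx =>
    map_mem_of_cstarGen inferInstance (σ g : D →⋆ₙₐ[ℂ] D)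
      (fun x hx => subset_cstarGen S (hS g x hx)) hx
  { toFun := fun g =>
      { toFun := fun x => (⟨σ g x.1, h g x.1 x.2⟩ : cstarGen S)
        invFun := fun x => (⟨σ g⁻¹ x.1, h g⁻¹ x.1 x.2⟩ : cstarGen S)
        left_inv := fun x => Subtype.ext (CcAlg.inv_apply_apply g x.1)
        right_inv := fun x => Subtype.ext (CcAlg.apply_inv_apply g x.1)
        map_mul' := fun x y => Subtype.ext (map_mul (σ g) x.1 y.1)
        map_add' := fun x y => Subtype.ext (map_add (σ g) x.1 y.1)
        map_star' := fun x => Subtype.ext (map_star (σ g) x.1)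
        map_smul' := fun c x => Subtype.ext (map_smul (σ g) c x.1) }
    map_one' := StarAlgEquiv.ext fun x => Subtype.ext (by
      change σ 1 x.1 = x.1
      rw [map_one]; rfl)
    map_mul' := fun g k => StarAlgEquiv.ext fun x => Subtype.ext (by
      change σ (g * k) x.1 = σ g (σ k x.1)
      rw [map_mul]; rfl) }

end Subalgebras

/-! ### The systems of the positive cone -/

section Systems

set_option linter.unusedSectionVars false

variable {Γ : Type u} [AddCommGroup Γ] [LinearOrder Γ] [IsOrderedAddMonoid Γ]

variable (Γ) in
/-- The positive cone `Γ⁺`, written multiplicatively. -/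
abbrev PosCone : Type u := Multiplicative {x : Γ // 0 ≤ x}

/-- The element `x` of the positive cone. -/
def PosCone.of (x : Γ) (hx : 0 ≤ x) : PosCone Γ := Multiplicative.ofAdd ⟨x, hx⟩

theorem PosCone.of_mul (x y : Γ) (hx : 0 ≤ x) (hy : 0 ≤ y) :
    PosCone.of x hx * PosCone.of y hy = PosCone.of (x + y) (add_nonneg hx hy) := rfl

/-- `ℓ^∞(Γ, E)`, the bounded `E`-valued functions on `Γ`. -/
abbrev LInf (Γ : Type u) (E : Type v) [NonUnitalCStarAlgebra E] : Type (max u v) :=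
  lp (fun _ : Γ => E) ∞

/-- The function `y ↦ f y`, which is bounded by `C`, as an element of `ℓ^∞(Γ, E)`. -/
def LInf.of {E : Type v} [NonUnitalCStarAlgebra E] (f : Γ → E) (C : ℝ) (h : ∀ y, ‖f y‖ ≤ C) :
    LInf Γ E :=
  ⟨f, memℓp_infty ⟨C, by rintro r ⟨y, rfl⟩; exact h y⟩⟩

/-- The action of `Γ` on `ℓ^∞(Γ, E)` by shifts, `(s · ξ)(y) = ξ(y - s)`. -/
def shift (Γ : Type u) [AddCommGroup Γ] (E : Type v) [NonUnitalCStarAlgebra E] :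
    Multiplicative Γ →* (LInf Γ E ≃⋆ₐ[ℂ] LInf Γ E) where
  toFun s :=
    { toFun := fun ξ => LInf.of (fun y => ξ (y - s.toAdd)) ‖ξ‖
        fun _ => lp.norm_apply_le_norm ENNReal.top_ne_zero ξ _
      invFun := fun ξ => LInf.of (fun y => ξ (y + s.toAdd)) ‖ξ‖
        fun _ => lp.norm_apply_le_norm ENNReal.top_ne_zero ξ _
      left_inv := fun ξ => lp.ext (funext fun y => congrArg ξ (add_sub_cancel_right y s.toAdd))
      right_inv := fun ξ => lp.ext (funext fun y => congrArg ξ (sub_add_cancel y s.toAdd))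
      map_mul' := fun _ _ => rfl
      map_add' := fun _ _ => rfl
      map_star' := fun _ => rfl
      map_smul' := fun _ _ => rfl }
  map_one' := StarAlgEquiv.ext fun ξ => lp.ext (funext fun y => congrArg ξ (sub_zero y))
  map_mul' s t := StarAlgEquiv.ext fun ξ => lp.ext (funext fun y =>
    congrArg ξ (sub_add_eq_sub_sub y s.toAdd t.toAdd))

theorem shift_apply {E : Type v} [NonUnitalCStarAlgebra E] (s : Multiplicative Γ) (ξ : LInf Γ E)
    (y : Γ) : shift Γ E s ξ y = ξ (y - s.toAdd) := rfl

variable {A : Type v} [NonUnitalCStarAlgebra A]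

/-- The function `μ_x(a) ∈ ℓ^∞(Γ, A)`, with `μ_x(a)(y) = α_{y-x}(a)` if `y ≥ x`, and `0` if
`y < x`. -/
def mu (α : PosCone Γ →* (A →⋆ₙₐ[ℂ] A)) (x : Γ) (a : A) : LInf Γ A :=
  LInf.of (fun y => if h : x ≤ y then α (PosCone.of (y - x) (sub_nonneg.2 h)) a else 0) ‖a‖
    fun y => by
      split_ifs with h
      · exact NonUnitalStarAlgHom.norm_apply_le _ a
      · rw [norm_zero]; exact norm_nonneg a

theorem shift_mu (α : PosCone Γ →* (A →⋆ₙₐ[ℂ] A)) (s : Multiplicative Γ) (x : Γ) (a : A) :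
    shift Γ A s (mu α x a) = mu α (x + s.toAdd) a := by
  refine lp.ext (funext fun y => ?_)
  rw [shift_apply]
  change dite _ _ _ = dite _ _ _
  by_cases h : x ≤ y - s.toAdd
  · have h' : x + s.toAdd ≤ y := le_sub_iff_add_le.1 h
    have e : y - s.toAdd - x = y - (x + s.toAdd) := by abel
    rw [dif_pos h, dif_pos h']
    simp only [e]
  · have h' : ¬ x + s.toAdd ≤ y := fun h' => h (le_sub_iff_add_le.2 h')
    rw [dif_neg h, dif_neg h']

/-- The generators `μ_x(a)` of `𝓑`. -/
def genB (α : PosCone Γ →* (A →⋆ₙₐ[ℂ] A)) : Set (LInf Γ A) :=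
  {ξ | ∃ (x : Γ) (a : A), ξ = mu α x a}

/-- The generators `μ_x(a) - μ_y(α_{y-x}(a))`, `x < y`, of `𝓘`. -/
def genI (α : PosCone Γ →* (A →⋆ₙₐ[ℂ] A)) : Set (LInf Γ A) :=
  {ξ | ∃ (x y : Γ) (h : x < y) (a : A),
    ξ = mu α x a - mu α y (α (PosCone.of (y - x) (sub_nonneg.2 h.le)) a)}

/-- The `C*`-algebra `𝓑`, the `C*`-subalgebra of `ℓ^∞(Γ, A)` generated by the elements `μ_x(a)`. -/
abbrev BAlg (α : PosCone Γ →* (A →⋆ₙₐ[ℂ] A)) : Type (max u v) := CStarGen (genB α)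

/-- The `C*`-algebra `𝓘`, the `C*`-subalgebra of `ℓ^∞(Γ, A)` (and of `𝓑`) generated by the elements
`μ_x(a) - μ_y(α_{y-x}(a))`, where `x < y`. -/
abbrev IAlg (α : PosCone Γ →* (A →⋆ₙₐ[ℂ] A)) : Type (max u v) := CStarGen (genI α)

theorem genI_subset (α : PosCone Γ →* (A →⋆ₙₐ[ℂ] A)) : genI α ⊆ cstarGen (genB α) := by
  rintro ξ ⟨x, y, h, a, rfl⟩
  exact sub_mem (subset_cstarGen _ ⟨x, a, rfl⟩) (subset_cstarGen _ ⟨y, _, rfl⟩)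

theorem shift_mem_genB (α : PosCone Γ →* (A →⋆ₙₐ[ℂ] A)) (s : Multiplicative Γ) (ξ : LInf Γ A)
    (hξ : ξ ∈ genB α) : shift Γ A s ξ ∈ genB α := by
  obtain ⟨x, a, rfl⟩ := hξ
  exact ⟨x + s.toAdd, a, shift_mu α s x a⟩

theorem shift_mem_genI (α : PosCone Γ →* (A →⋆ₙₐ[ℂ] A)) (s : Multiplicative Γ) (ξ : LInf Γ A)
    (hξ : ξ ∈ genI α) : shift Γ A s ξ ∈ genI α := by
  obtain ⟨x, y, h, a, rfl⟩ := hξ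
  refine ⟨x + s.toAdd, y + s.toAdd, add_lt_add_left h _, a, ?_⟩
  have e : y + s.toAdd - (x + s.toAdd) = y - x := by abel
  rw [map_sub, shift_mu, shift_mu]
  simp only [e]

/-- The inclusion of `𝓘` in `𝓑`. -/
def inclI (α : PosCone Γ →* (A →⋆ₙₐ[ℂ] A)) : IAlg α →⋆ₙₐ[ℂ] BAlg α :=
  CStarGen.incl (genI_subset α)

/-- The action `β` of `Γ` on `𝓑` given by the shift, so that `β_s(μ_x(a)) = μ_{x+s}(a)`. -/
def beta (α : PosCone Γ →* (A →⋆ₙₐ[ℂ] A)) : Multiplicative Γ →* (BAlg α ≃⋆ₐ[ℂ] BAlg α) :=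
  restrictAction (shift Γ A) (genB α) (shift_mem_genB α)

/-- The restriction of the action `β` to `𝓘`. -/
def betaI (α : PosCone Γ →* (A →⋆ₙₐ[ℂ] A)) : Multiplicative Γ →* (IAlg α ≃⋆ₐ[ℂ] IAlg α) :=
  restrictAction (shift Γ A) (genI α) (shift_mem_genI α)

theorem inclI_equivariant (α : PosCone Γ →* (A →⋆ₙₐ[ℂ] A)) (s : Multiplicative Γ) (ξ : IAlg α) :
    inclI α (betaI α s ξ) = beta α s (inclI α ξ) := rfl

/-- The function `1_s ∈ ℓ^∞(Γ)`, with `1_s(t) = 1` if `t ≥ s`, and `0` if `t < s`. -/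
def oneFrom (s : Γ) : LInf Γ ℂ :=
  LInf.of (fun t => if s ≤ t then 1 else 0) 1 fun t => by split_ifs <;> simp

theorem shift_oneFrom (x : Multiplicative Γ) (s : Γ) :
    shift Γ ℂ x (oneFrom s) = oneFrom (s + x.toAdd) := by
  refine lp.ext (funext fun t => ?_)
  rw [shift_apply]
  change ite _ _ _ = ite _ _ _
  simp only [le_sub_iff_add_le]

variable (Γ) in
/-- The functions `1_s`, `s ∈ Γ`. -/
def genBGamma : Set (LInf Γ ℂ) := {f | ∃ s : Γ, f = oneFrom s}

variable (Γ) in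
/-- The functions `1_s - 1_t`, `s < t`. -/
def genBGammaInf : Set (LInf Γ ℂ) := {f | ∃ s t : Γ, s < t ∧ f = oneFrom s - oneFrom t}

variable (Γ) in
/-- The `C*`-algebra `B_Γ`, the `C*`-subalgebra of `ℓ^∞(Γ)` generated by the functions `1_s`. It is
the closed linear span of these functions, see `coe_cstarGen_genBGamma`. -/
abbrev BGamma : Type u := CStarGen (genBGamma Γ)

variable (Γ) in
/-- The `C*`-algebra `B_{Γ,∞}`, generated by the functions `1_s - 1_t`, where `s < t`. It is the
closed linear span of these functions, see `coe_cstarGen_genBGammaInf`. -/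
abbrev BGammaInf : Type u := CStarGen (genBGammaInf Γ)

variable (Γ) in
theorem genBGammaInf_subset : genBGammaInf Γ ⊆ cstarGen (genBGamma Γ) := by
  rintro f ⟨s, t, -, rfl⟩
  exact sub_mem (subset_cstarGen _ ⟨s, rfl⟩) (subset_cstarGen _ ⟨t, rfl⟩)

theorem shift_mem_genBGamma (x : Multiplicative Γ) (f : LInf Γ ℂ) (hf : f ∈ genBGamma Γ) :
    shift Γ ℂ x f ∈ genBGamma Γ := by
  obtain ⟨s, rfl⟩ := hf
  exact ⟨s + x.toAdd, shift_oneFrom x s⟩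

theorem shift_mem_genBGammaInf (x : Multiplicative Γ) (f : LInf Γ ℂ) (hf : f ∈ genBGammaInf Γ) :
    shift Γ ℂ x f ∈ genBGammaInf Γ := by
  obtain ⟨s, t, h, rfl⟩ := hf
  refine ⟨s + x.toAdd, t + x.toAdd, add_lt_add_left h _, ?_⟩
  rw [map_sub, shift_oneFrom, shift_oneFrom]

theorem oneFrom_mul_oneFrom (s t : Γ) : oneFrom s * oneFrom t = oneFrom (max s t) := by
  refine lp.ext (funext fun r => ?_)
  change (if s ≤ r then (1 : ℂ) else 0) * (if t ≤ r then 1 else 0) = if max s t ≤ r then 1 else 0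
  by_cases h : s ≤ r <;> by_cases h' : t ≤ r <;> simp [h, h']

theorem star_oneFrom (s : Γ) : star (oneFrom s) = oneFrom s := by
  refine lp.ext (funext fun r => ?_)
  change star (ite _ _ _) = ite _ _ _
  split_ifs <;> simp

/-- If a set `S` of self-adjoint elements is, up to `0`, closed under products, then `C*(S)` is its
closed linear span. -/
theorem coe_cstarGen_of_mul {D : Type*} [NonUnitalCStarAlgebra D] {S : Set D}
    (hs : ∀ f ∈ S, star f = f) (hm : ∀ f ∈ S, ∀ g ∈ S, f * g ∈ S ∨ f * g = 0) :
    (cstarGen S : Set D) = closure (Submodule.span ℂ S) := by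
  have h : (NonUnitalStarAlgebra.adjoin ℂ S : Set D) = Submodule.span ℂ S := by
    have h1 := congrArg (fun T : Submodule ℂ D => (T : Set D))
      (NonUnitalStarAlgebra.adjoin_eq_span (R := ℂ) S)
    refine h1.trans (congrArg _ (le_antisymm (Submodule.span_le.2 ?_) (Submodule.span_mono ?_)))
    · intro x hx
      suffices hx' : x ∈ S ∨ x = 0 by
        rcases hx' with h | h
        · exact Submodule.subset_span h
        · rw [h]; exact zero_mem _
      induction hx using Subsemigroup.closure_induction with
      | mem x hx =>
        rcases hx with hx | hx
        · exact Or.inl hx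
        · refine Or.inl ?_
          have := hs _ (Set.mem_star.1 hx)
          rw [star_star] at this
          rw [this]; exact hx
      | mul x y _ _ hx hy =>
        rcases hx with hx | hx
        · rcases hy with hy | hy
          · exact hm x hx y hy
          · right; rw [hy, mul_zero]
        · right; rw [hx, zero_mul]
    · exact fun x hx => Subsemigroup.subset_closure (Or.inl hx)
  rw [← h]; rfl

variable (Γ) in
theorem coe_cstarGen_genBGamma : (cstarGen (genBGamma Γ) : Set (LInf Γ ℂ)) =
    closure (Submodule.span ℂ (genBGamma Γ)) := by
  refine coe_cstarGen_of_mul ?_ ?_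
  · rintro f ⟨s, rfl⟩
    exact star_oneFrom s
  · rintro f ⟨s, rfl⟩ g ⟨t, rfl⟩
    exact Or.inl ⟨max s t, oneFrom_mul_oneFrom s t⟩

variable (Γ) in
theorem coe_cstarGen_genBGammaInf : (cstarGen (genBGammaInf Γ) : Set (LInf Γ ℂ)) =
    closure (Submodule.span ℂ (genBGammaInf Γ)) := by
  refine coe_cstarGen_of_mul ?_ ?_
  · rintro f ⟨s, t, -, rfl⟩
    rw [star_sub, star_oneFrom, star_oneFrom]
  · rintro f ⟨s, t, h, rfl⟩ g ⟨s', t', h', rfl⟩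
    have e : (oneFrom s - oneFrom t) * (oneFrom s' - oneFrom t') =
        oneFrom (max s s') - oneFrom (max (max s s') (min t t')) := by
      rw [sub_mul, mul_sub, mul_sub]
      simp only [oneFrom_mul_oneFrom]
      rcases le_total t t' with h1 | h1
      · rw [min_eq_left h1, max_eq_right h1, max_eq_right (h.le.trans h1),
          max_comm (max s s') t, ← max_assoc, max_eq_left h.le]
        abel
      · rw [min_eq_right h1, max_eq_left h1, max_eq_left (h'.le.trans h1),
          max_assoc, max_eq_right h'.le]
        abel
    rw [e]
    rcases le_or_gt (min t t') (max s s') with h1 | h1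
    · right; rw [max_eq_left h1, sub_self]
    · left; exact ⟨max s s', max (max s s') (min t t'), lt_max_of_lt_right h1, rfl⟩

variable (Γ) in
/-- The inclusion of `B_{Γ,∞}` in `B_Γ`. -/
def inclBGammaInf : BGammaInf Γ →⋆ₙₐ[ℂ] BGamma Γ :=
  CStarGen.incl (genBGammaInf_subset Γ)

variable (Γ) in
/-- The action `τ` of `Γ` on `B_Γ` by translation, so that `τ_x(1_s) = 1_{s+x}`. -/
def tau : Multiplicative Γ →* (BGamma Γ ≃⋆ₐ[ℂ] BGamma Γ) :=
  restrictAction (shift Γ ℂ) (genBGamma Γ) shift_mem_genBGamma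

variable (Γ) in
/-- The restriction of the action `τ` to `B_{Γ,∞}`. -/
def tauInf : Multiplicative Γ →* (BGammaInf Γ ≃⋆ₐ[ℂ] BGammaInf Γ) :=
  restrictAction (shift Γ ℂ) (genBGammaInf Γ) shift_mem_genBGammaInf

/-- An action of `Γ⁺` by automorphisms, regarded as an action by endomorphisms. -/
def toEnd (α : PosCone Γ →* (A ≃⋆ₐ[ℂ] A)) : PosCone Γ →* (A →⋆ₙₐ[ℂ] A) where
  toFun x := (α x : A →⋆ₙₐ[ℂ] A)
  map_one' := by rw [map_one]; rfl
  map_mul' x y := by rw [map_mul]; rfl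

/-- For an action of `Γ⁺` by automorphisms, `α_s` for `s ∈ Γ`: if `s < 0`, then
`α_s = α_{-s}⁻¹`. -/
def extFun (α : PosCone Γ →* (A ≃⋆ₐ[ℂ] A)) (s : Γ) : A ≃⋆ₐ[ℂ] A :=
  if h : 0 ≤ s then α (PosCone.of s h) else (α (PosCone.of (-s) (neg_nonneg.2 (not_le.1 h).le)))⁻¹

theorem extFun_sub (α : PosCone Γ →* (A ≃⋆ₐ[ℂ] A)) (a b : Γ) (ha : 0 ≤ a) (hb : 0 ≤ b) :
    extFun α (a - b) = α (PosCone.of a ha) * (α (PosCone.of b hb))⁻¹ := by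
  unfold extFun
  split_ifs with h
  · rw [eq_mul_inv_iff_mul_eq, ← map_mul, PosCone.of_mul]
    simp only [sub_add_cancel]
  · have h' : 0 ≤ -(a - b) := neg_nonneg.2 (not_le.1 h).le
    rw [inv_eq_iff_eq_inv, mul_inv_rev, inv_inv, eq_mul_inv_iff_mul_eq, ← map_mul,
      PosCone.of_mul]
    have e : -(a - b) + a = b := by abel
    simp only [e]

/-- The extension of an action `α` of `Γ⁺` by automorphisms to an action of `Γ`. -/
def extAction (α : PosCone Γ →* (A ≃⋆ₐ[ℂ] A)) : Multiplicative Γ →* (A ≃⋆ₐ[ℂ] A) where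
  toFun s := extFun α s.toAdd
  map_one' := by
    change extFun α 0 = 1
    rw [← sub_zero (0 : Γ), extFun_sub α 0 0 le_rfl le_rfl, mul_inv_cancel]
  map_mul' s t := by
    change extFun α (s.toAdd + t.toAdd) = extFun α s.toAdd * extFun α t.toAdd
    generalize s.toAdd = x
    generalize t.toAdd = y
    have dec : ∀ z : Γ, ∃ a b : Γ, 0 ≤ a ∧ 0 ≤ b ∧ z = a - b := fun z => by
      rcases le_total 0 z with h | h
      · exact ⟨z, 0, h, le_rfl, (sub_zero z).symm⟩
      · exact ⟨0, -z, le_rfl, neg_nonneg.2 h, by rw [zero_sub, neg_neg]⟩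
    obtain ⟨a, b, ha, hb, rfl⟩ := dec x
    obtain ⟨c, d, hc, hd, rfl⟩ := dec y
    have e : a - b + (c - d) = (a + c) - (b + d) := by abel
    have comm : ∀ p q : PosCone Γ, Commute (α p) (α q) := fun p q => by
      rw [Commute, SemiconjBy, ← map_mul, ← map_mul, mul_comm]
    rw [e, extFun_sub α _ _ (add_nonneg ha hc) (add_nonneg hb hd), extFun_sub α _ _ ha hb,
      extFun_sub α _ _ hc hd, ← PosCone.of_mul a c ha hc, ← PosCone.of_mul b d hb hd, map_mul,
      map_mul, mul_inv_rev, (comm (PosCone.of b hb) (PosCone.of d hd)).inv_inv.eq.symm,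
      mul_assoc, mul_assoc, ← mul_assoc (α (PosCone.of c hc)),
      ((comm (PosCone.of c hc) (PosCone.of b hb)).inv_right).eq, mul_assoc]

/-- The action `x ↦ σ_x⁻¹` of an abelian group. -/
def invAction {G : Type*} [CommGroup G] (σ : G →* (A ≃⋆ₐ[ℂ] A)) : G →* (A ≃⋆ₐ[ℂ] A) where
  toFun x := (σ x)⁻¹
  map_one' := by rw [map_one, inv_one]
  map_mul' x y := by rw [mul_comm, map_mul, mul_inv_rev]

/-- The action `τ ⊗ α⁻¹` of `Γ` on `B_Γ ⊗ A`. -/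
def tauTensor (α : PosCone Γ →* (A ≃⋆ₐ[ℂ] A)) :
    Multiplicative Γ →* (CStarTensor (BGamma Γ) A ≃⋆ₐ[ℂ] CStarTensor (BGamma Γ) A) :=
  tensorAction (tau Γ) (invAction (extAction α))

/-- The action `τ ⊗ α⁻¹` of `Γ` on `B_{Γ,∞} ⊗ A`. -/
def tauTensorInf (α : PosCone Γ →* (A ≃⋆ₐ[ℂ] A)) :
    Multiplicative Γ →* (CStarTensor (BGammaInf Γ) A ≃⋆ₐ[ℂ] CStarTensor (BGammaInf Γ) A) :=
  tensorAction (tauInf Γ) (invAction (extAction α))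

variable (Γ A) in
/-- The canonical homomorphism `B_{Γ,∞} ⊗ A → B_Γ ⊗ A`. -/
def inclTensor : CStarTensor (BGammaInf Γ) A →⋆ₙₐ[ℂ] CStarTensor (BGamma Γ) A :=
  tensorMap (inclBGammaInf Γ) (NonUnitalStarAlgHom.id ℂ A)

theorem inclTensor_equivariant (α : PosCone Γ →* (A ≃⋆ₐ[ℂ] A)) (s : Multiplicative Γ)
    (x : CStarTensor (BGammaInf Γ) A) :
    inclTensor Γ A (tauTensorInf α s x) = tauTensor α s (inclTensor Γ A x) :=
  tensorMap_tensorAction (tauInf Γ) (tau Γ) (invAction (extAction α)) (inclBGammaInf Γ)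
    (fun _ _ => rfl) s x

end Systems

end PisoCrossed

end

noncomputable section

namespace PisoCrossed

universe u v w

/-! ### Extension of bounded `*`-homomorphisms to completions -/

/-! The isomorphism is δ(f ⊗ a)(y) = f(y) α_y(a). For f = 1_x and y ≥ x the value is α_y(a) =
α_{y-x}(α_x(a)), so δ(1_x ⊗ a) = μ_x(α_x(a)) (`twist_oneFrom`). Since α_x is onto, the tensors 1_x ⊗
a go to exactly the generators of 𝓑, and the tensors (1_s - 1_t) ⊗ a with s < t to exactly those of
𝓘 (`genB_eq`, `genI_eq`). The identity α_{y-x}(a) = α_y(α_x⁻¹(a)) turns τ ⊗ α⁻¹ into the shift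
(`shift_twist`).

The analytic content is that δ is isometric on the maximal tensor product (`norm_delta`). It is
contractive because it comes from a commuting pair: scalar functions, and the functions y ↦ α_y(a),
inside the bounded functions with values in the unitization of A. The reverse estimate rests on B_Γ
and B_{Γ,∞} being closed spans of projections. Finitely many commuting projections lie in the span
of a finite orthogonal family, so a dense set of tensors has the form x = ∑ qᵢ ⊗ bᵢ with orthogonal
projections qᵢ. Any commuting pair sends x to the image of (bᵢ) under a `*`-homomorphism of a finite
power of A, so the maximal norm of x is at most max ‖bᵢ‖. Conversely each nonzero qᵢ equals 1 at
some point y where the other projections vanish, so δ(x)(y) = α_y(bᵢ) has norm ‖bᵢ‖. This computes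
the maximal norm directly, with no appeal to nuclearity. An isometry is injective with closed range,
so its range is the whole generated `C*`-algebra (`range_delta`).

The crossed products follow by functoriality: an equivariant isomorphism induces an isomorphism,
with a δ_s ↦ δ(a) δ_s. For the ideals, the same construction over B_{Γ,∞} gives an isomorphism onto
𝓘 that forms a commuting square with δ and the two inclusions (`deltaB_inclTensor`). Passing to
crossed products keeps the square commutative and its isomorphisms onto, so the images of the ideals
correspond; injectivity of the canonical maps of the ideal crossed products plays no role. -/

theorem continuous_starHom {D E : Type*} [NonUnitalCStarAlgebra D] [NonUnitalCStarAlgebra E]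
    (f : D →⋆ₙₐ[ℂ] E) : Continuous f :=
  AddMonoidHomClass.continuous_of_bound f 1 fun x => by
    rw [one_mul]; exact NonUnitalStarAlgHom.norm_apply_le f x

namespace CStarCompletion

open UniformSpace

variable {X : Type*} [NonUnitalRing X] [StarRing X] [Module ℂ X] {p : CStarSeminorm X}
  {E : Type*} [NonUnitalCStarAlgebra E]

theorem uniformContinuous_of_norm_le (f : X →⋆ₙₐ[ℂ] E) (hf : ∀ x, ‖f x‖ ≤ p.toSeminorm x) :
    UniformContinuous (fun x : Pre p => f (show X from x)) :=
  let g : Pre p →+ E :=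
    { toFun := fun x => f (show X from x), map_zero' := map_zero f, map_add' := map_add f }
  AddMonoidHomClass.uniformContinuous_of_bound g 1 fun x => by
    rw [one_mul]; exact hf x

/-- The extension to the completion of a `*`-homomorphism into a `C*`-algebra which is bounded by
the seminorm. -/
def lift (f : X →⋆ₙₐ[ℂ] E) (hf : ∀ x, ‖f x‖ ≤ p.toSeminorm x) : CStarCompletion p →⋆ₙₐ[ℂ] E :=
  let F : CStarCompletion p → E := Completion.extension (fun x : Pre p => f (show X from x))
  have hF : Continuous F := Completion.continuous_extension
  have hmk : ∀ x : X, F (mk x) = f x := fun x =>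
    Completion.extension_coe (uniformContinuous_of_norm_le f hf) x
  { toFun := F
    map_smul' := fun c a => by
      induction a using induction_on with
      | hp => exact isClosed_eq (hF.comp (continuous_const_smul c)) (hF.const_smul c)
      | ih a => rw [← mk_smul, hmk, hmk]; exact map_smul f c a
    map_zero' := (hmk 0).trans (map_zero f)
    map_add' := fun a b => by
      induction a, b using induction_on₂ with
      | hp => exact isClosed_eq (by fun_prop) (by fun_prop)
      | ih a b => rw [← mk_add, hmk, hmk, hmk, map_add]
    map_mul' := fun a b => by
      induction a, b using induction_on₂ with
      | hp => exact isClosed_eq (by fun_prop) (by fun_prop)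
      | ih a b => rw [← mk_mul, hmk, hmk, hmk, map_mul]
    map_star' := fun a => by
      induction a using induction_on with
      | hp => exact isClosed_eq (hF.comp continuous_star') (hF.star)
      | ih a => rw [← mk_star, hmk, hmk, map_star] }

theorem lift_mk (f : X →⋆ₙₐ[ℂ] E) (hf : ∀ x, ‖f x‖ ≤ p.toSeminorm x) (x : X) :
    lift f hf (mk x) = f x :=
  Completion.extension_coe (uniformContinuous_of_norm_le f hf) x

end CStarCompletion

/-! ### The maximal norm -/

section MaxNorm

variable {C : Type u} {D : Type v} [NonUnitalCStarAlgebra C] [NonUnitalCStarAlgebra D]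

/-- The supremum defining the maximal norm runs only over algebras in the universe `max u v`, so the
target is confined to that universe. The bounded functions on `Γ` with values in the unitization of
`A` belong to it. -/
theorem norm_hom_le_maxSeminorm {E : Type max u v} [NonUnitalCStarAlgebra E]
    (P : CommutingPair C D E) (x : C ⊗[ℂ] D) : ‖P.hom x‖ ≤ (maxSeminorm C D).toSeminorm x := by
  refine CStarSeminorm.le_sup (q := CStarSeminorm.ofHom P.hom) ?_ x
  exact ⟨E, _, P, rfl⟩

theorem maxSeminorm_tmul_le (c : C) (d : D) :
    (maxSeminorm C D).toSeminorm (c ⊗ₜ d) ≤ ‖c‖ * ‖d‖ := by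
  refine CStarSeminorm.sup_le (by positivity) ?_
  rintro q ⟨E, _, P, rfl⟩
  change ‖P.hom (c ⊗ₜ d)‖ ≤ _
  rw [CommutingPair.hom_tmul]
  exact (norm_mul_le _ _).trans (mul_le_mul (NonUnitalStarAlgHom.norm_apply_le P.left c)
    (NonUnitalStarAlgHom.norm_apply_le P.right d) (norm_nonneg _) (norm_nonneg _))

/-- The canonical linear map of the algebraic tensor product into the maximal one. -/
def CStarTensor.ofAlg : C ⊗[ℂ] D →ₗ[ℂ] CStarTensor C D where
  toFun x := CStarCompletion.mk (p := maxSeminorm C D) x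
  map_add' := CStarCompletion.mk_add _
  map_smul' := CStarCompletion.mk_smul _

theorem CStarTensor.norm_ofAlg (x : C ⊗[ℂ] D) :
    ‖CStarTensor.ofAlg x‖ = (maxSeminorm C D).toSeminorm x :=
  CStarCompletion.norm_mk (p := maxSeminorm C D) x

theorem CStarTensor.denseRange_ofAlg :
    DenseRange (CStarTensor.ofAlg : C ⊗[ℂ] D →ₗ[ℂ] CStarTensor C D) :=
  CStarCompletion.denseRange_mk (maxSeminorm C D)

/-- The cross-norm estimate gives the bound ‖d‖. Continuity in the first factor is what passes from
a dense span in `C` to all of `C`. -/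
theorem CStarTensor.continuous_tmul_left (d : D) :
    Continuous (fun c : C => CStarTensor.ofAlg (c ⊗ₜ[ℂ] d)) := by
  let f : C →ₗ[ℂ] CStarTensor C D :=
    CStarTensor.ofAlg ∘ₗ (TensorProduct.mk ℂ C D).flip d
  refine AddMonoidHomClass.continuous_of_bound f ‖d‖ fun c => ?_
  rw [mul_comm]
  exact (CStarTensor.norm_ofAlg _).le.trans (maxSeminorm_tmul_le c d)

/-- If `S` spans a dense subspace of `C`, then the tensors `c ⊗ d` with `c ∈ S` span a dense
subspace of `C ⊗ D`. -/
theorem CStarTensor.closure_ofAlg_span {S : Set C}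
    (hS : closure (Submodule.span ℂ S : Set C) = Set.univ) :
    closure (CStarTensor.ofAlg '' (Submodule.span ℂ {x : C ⊗[ℂ] D | ∃ c ∈ S, ∃ d, x = c ⊗ₜ d} :
      Set (C ⊗[ℂ] D))) = Set.univ := by
  set W := Submodule.span ℂ {x : C ⊗[ℂ] D | ∃ c ∈ S, ∃ d, x = c ⊗ₜ d}
  let K : Submodule ℂ (CStarTensor C D) := (W.map CStarTensor.ofAlg).topologicalClosure
  have hK : IsClosed (K : Set (CStarTensor C D)) := Submodule.isClosed_topologicalClosure _
  -- For fixed d, the elements c with c ⊗ d in K form a closed subspace containing S, hence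
  -- everything.
  have htmul : ∀ (c : C) (d : D), CStarTensor.ofAlg (c ⊗ₜ[ℂ] d) ∈ K := fun c d => by
    have h1 : closure (Submodule.span ℂ S : Set C) ⊆
        {c | CStarTensor.ofAlg (c ⊗ₜ[ℂ] d) ∈ K} := by
      refine closure_minimal ?_ (hK.preimage (CStarTensor.continuous_tmul_left d))
      have h2 : Submodule.span ℂ S ≤
          K.comap (CStarTensor.ofAlg ∘ₗ (TensorProduct.mk ℂ C D).flip d) := by
        refine Submodule.span_le.2 fun c hc => ?_
        exact Submodule.le_topologicalClosure _
          (Submodule.mem_map_of_mem (Submodule.subset_span ⟨c, hc, d, rfl⟩))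
      exact h2
    rw [hS] at h1
    exact h1 (Set.mem_univ c)
  have hall : ∀ x : C ⊗[ℂ] D, CStarTensor.ofAlg x ∈ K := fun x => by
    induction x using TensorProduct.induction_on with
    | zero => rw [map_zero]; exact K.zero_mem
    | add x y hx hy => rw [map_add]; exact K.add_mem hx hy
    | tmul c d => exact htmul c d
  have h : closure (Set.range (CStarTensor.ofAlg : C ⊗[ℂ] D →ₗ[ℂ] CStarTensor C D)) ⊆ K :=
    closure_minimal (by rintro _ ⟨x, rfl⟩; exact hall x) hK
  rw [CStarTensor.denseRange_ofAlg.closure_eq] at h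
  exact Set.univ_subset_iff.1 h

end MaxNorm

/-! ### Orthogonal families of projections -/

section Projections

/-- Finitely many commuting projections lie in the span of a finite orthogonal family of
projections. -/
theorem exists_orthogonal_projections {C : Type*} [NonUnitalRing C] [StarRing C] [Module ℂ C]
    (hc : ∀ x y : C, x * y = y * x) (T : Finset C) (hT : ∀ p ∈ T, IsStarProjection p) :
    ∃ (ι : Type) (_ : Fintype ι) (q : ι → C), (∀ i, IsStarProjection (q i)) ∧
      (Pairwise fun i j => q i * q j = 0) ∧ ∀ p ∈ T, p ∈ Submodule.span ℂ (Set.range q) := by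
  classical
  induction T using Finset.induction_on with
  | empty => exact ⟨Empty, inferInstance, Empty.elim, by simp, fun i => i.elim, by simp⟩
  | insert p T hpT ih =>
    obtain ⟨ι, _, q, hq, ho, hs⟩ := ih fun p hp => hT p (Finset.mem_insert_of_mem hp)
    have hp : IsStarProjection p := hT p (Finset.mem_insert_self _ _)
    have hpp : p * p = p := hp.isIdempotentElem
    have hqq : ∀ i, q i * q i = q i := fun i => (hq i).isIdempotentElem
    have hps : star p = p := hp.isSelfAdjoint
    have hqs : ∀ i, star (q i) = q i := fun i => (hq i).isSelfAdjoint
    have hqs' : ∀ i, q i * (∑ j, q j) = q i := fun i => by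
      rw [Finset.mul_sum, Finset.sum_eq_single i (fun j _ hj => ho hj.symm) (by simp), hqq]
    set s := ∑ j, q j with hsdef
    have hss : s * s = s := by
      conv_lhs => rw [hsdef, Finset.sum_mul]
      exact Finset.sum_congr rfl fun i _ => hqs' i
    have hsstar : star s = s := by rw [hsdef, star_sum]; simp only [hqs]
    -- The new projection p cuts each qᵢ into qᵢp and qᵢ - qᵢp, and p - sp is the part of p outside
    -- s = ∑ qⱼ. Differences replace products with 1 - p because C need not have a unit.
    let r : ι ⊕ ι ⊕ Unit → C := Sum.elim (fun i => q i * p)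
      (Sum.elim (fun i => q i - q i * p) fun _ => p - s * p)
    -- Commutativity moves every factor p to the right, where p² = p collapses it; what remains are
    -- relations among the qᵢ and s.
    have e1 : ∀ x y : C, (x * p) * (y * p) = (x * y) * p := fun x y => by
      rw [hc y p, mul_assoc, ← mul_assoc p, hpp, hc p y, mul_assoc]
    have e2 : ∀ x y : C, x * (y * p) = (x * y) * p := fun x y => (mul_assoc _ _ _).symm
    have e3 : ∀ x y : C, (x * p) * y = (x * y) * p := fun x y => by
      rw [mul_assoc, hc p y, mul_assoc]
    have e5 : ∀ x : C, x * p * p = x * p := fun x => by rw [mul_assoc, hpp]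
    have e4 : ∀ x : C, p * x = x * p := hc p
    have hstar : ∀ x : C, star x = x → star (x * p) = x * p := fun x hx => by
      rw [star_mul, hx, hps, hc]
    have hr : ∀ i, IsStarProjection (r i) := by
      rintro (i | i | -)
      · refine ⟨?_, hstar _ (hqs i)⟩
        change q i * p * (q i * p) = q i * p
        rw [e1, hqq]
      · refine ⟨?_, ?_⟩
        · change (q i - q i * p) * (q i - q i * p) = q i - q i * p
          simp only [mul_sub, sub_mul, e2, e3 (q i) (q i), e5, hqq]; abel
        · change star (q i - q i * p) = q i - q i * p
          rw [star_sub, hstar _ (hqs i), hqs]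
      · refine ⟨?_, ?_⟩
        · change (p - s * p) * (p - s * p) = p - s * p
          simp only [mul_sub, sub_mul, e1, hpp, hss, e4 (s * p), mul_assoc s p p]; abel
        · change star (p - s * p) = p - s * p
          rw [star_sub, hstar _ hsstar, hps]
    have hro : Pairwise fun i j => r i * r j = 0 := by
      have hq0 : ∀ i j : ι, i ≠ j → q i * q j = 0 := fun i j h => ho h
      have sym : ∀ i j, r i * r j = 0 → r j * r i = 0 := fun i j h => (hc _ _).trans h
      have h12 : ∀ i j, r (.inl i) * r (.inr (.inl j)) = 0 := fun i j => by
        change q i * p * (q j - q j * p) = 0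
        simp only [mul_sub, e2, e3 (q i) (q j), e5, sub_self]
      have h13 : ∀ i j, r (.inl i) * r (.inr (.inr j)) = 0 := fun i j => by
        change q i * p * (p - s * p) = 0
        simp only [mul_sub, e1, hqs', mul_assoc (q i) p p, hpp, sub_self]
      have h23 : ∀ i j, r (.inr (.inl i)) * r (.inr (.inr j)) = 0 := fun i j => by
        change (q i - q i * p) * (p - s * p) = 0
        simp only [mul_sub, sub_mul, e2, e3 (q i) s, e5, hqs', sub_self]
      rintro (i | i | i) (j | j | j) hij
      · change q i * p * (q j * p) = 0
        rw [e1, hq0 i j (fun h => hij (by rw [h])), zero_mul]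
      · exact h12 i j
      · exact h13 i j
      · exact sym _ _ (h12 j i)
      · change (q i - q i * p) * (q j - q j * p) = 0
        simp only [mul_sub, sub_mul, e2, e3 (q i) (q j), hq0 i j (fun h => hij (by rw [h])),
          zero_mul, sub_self]
      · exact h23 i j
      · exact sym _ _ (h13 j i)
      · exact sym _ _ (h23 j i)
      · exact absurd rfl hij
    have hmem : ∀ i, r i ∈ Submodule.span ℂ (Set.range r) := fun i =>
      Submodule.subset_span ⟨i, rfl⟩
    have hqmem : Submodule.span ℂ (Set.range q) ≤ Submodule.span ℂ (Set.range r) := by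
      refine Submodule.span_le.2 ?_
      rintro _ ⟨i, rfl⟩
      have h : q i = r (.inl i) + r (.inr (.inl i)) := (add_sub_cancel (q i * p) (q i)).symm
      rw [h]
      exact add_mem (hmem _) (hmem _)
    refine ⟨ι ⊕ ι ⊕ Unit, inferInstance, r, hr, hro, fun p' hp' => ?_⟩
    rcases Finset.mem_insert.1 hp' with rfl | h
    -- The pieces qᵢp add up to sp, and the last piece supplies the rest of p.
    · have h : p' = ∑ i, r (.inl i) + r (.inr (.inr ())) := by
        change p' = ∑ i, q i * p' + (p' - s * p')
        rw [← Finset.sum_mul]; exact (add_sub_cancel _ _).symm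
      rw [h]
      exact add_mem (sum_mem fun i _ => hmem _) (hmem _)
    · exact hqmem (hs p' h)

/-- The finite set T is fixed before the family q is known: it collects the first legs of the
tensors in a representation of x. Any finite family whose span contains T can then carry x, and for
a sum the union of the two sets makes one family serve both summands. -/
theorem exists_finset_of_mem_span_tmul {C D : Type*} [AddCommGroup C] [Module ℂ C]
    [AddCommGroup D] [Module ℂ D] {S : Set C} {x : C ⊗[ℂ] D}
    (hx : x ∈ Submodule.span ℂ {x : C ⊗[ℂ] D | ∃ c ∈ S, ∃ d, x = c ⊗ₜ d}) :
    ∃ T : Finset C, (∀ c ∈ T, c ∈ S) ∧ ∀ (ι : Type) [Fintype ι] (q : ι → C),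
      (∀ c ∈ T, c ∈ Submodule.span ℂ (Set.range q)) →
        ∃ b : ι → D, x = ∑ i, q i ⊗ₜ b i := by
  classical
  induction hx using Submodule.span_induction with
  | mem x hx =>
    obtain ⟨c, hc, d, rfl⟩ := hx
    refine ⟨{c}, by simpa using hc, fun ι _ q h => ?_⟩
    obtain ⟨l, hl⟩ := (Submodule.mem_span_range_iff_exists_fun ℂ).1
      (h c (Finset.mem_singleton_self c))
    -- The coefficients of c in the family q are moved across the tensor sign.
    refine ⟨fun i => l i • d, ?_⟩
    rw [← hl, TensorProduct.sum_tmul]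
    exact Finset.sum_congr rfl fun i _ => TensorProduct.smul_tmul _ _ _
  | zero => exact ⟨∅, by simp, fun ι _ q _ => ⟨0, by simp⟩⟩
  | add x y _ _ hx hy =>
    obtain ⟨T₁, h₁, h₁'⟩ := hx
    obtain ⟨T₂, h₂, h₂'⟩ := hy
    refine ⟨T₁ ∪ T₂, fun c hc => (Finset.mem_union.1 hc).elim (h₁ c) (h₂ c),
      fun ι _ q h => ?_⟩
    obtain ⟨b₁, hb₁⟩ := h₁' ι q fun c hc => h c (Finset.mem_union_left _ hc)
    obtain ⟨b₂, hb₂⟩ := h₂' ι q fun c hc => h c (Finset.mem_union_right _ hc)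
    refine ⟨b₁ + b₂, ?_⟩
    rw [hb₁, hb₂, ← Finset.sum_add_distrib]
    exact Finset.sum_congr rfl fun i _ => (TensorProduct.tmul_add _ _ _).symm
  | smul a x _ hx =>
    obtain ⟨T, h, h'⟩ := hx
    refine ⟨T, h, fun ι _ q hq => ?_⟩
    obtain ⟨b, hb⟩ := h' ι q hq
    refine ⟨a • b, ?_⟩
    rw [hb, Finset.smul_sum]
    exact Finset.sum_congr rfl fun i _ => (TensorProduct.tmul_smul _ _ _).symm

variable {C : Type u} {D : Type v} {E : Type w} [NonUnitalCStarAlgebra C]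
  [NonUnitalCStarAlgebra D] [NonUnitalCStarAlgebra E]

/-- The `*`-homomorphism `b ↦ ∑ φ(qᵢ) ψ(bᵢ)` of a commuting pair `(φ, ψ)` and an orthogonal
family of projections `qᵢ`. -/
def CommutingPair.sumHom (P : CommutingPair C D E) {ι : Type} [Fintype ι] {q : ι → C}
    (hq : ∀ i, IsStarProjection (q i)) (ho : Pairwise fun i j => q i * q j = 0) :
    (ι → D) →⋆ₙₐ[ℂ] E where
  toFun b := P.hom (∑ i, q i ⊗ₜ b i)
  map_smul' c b := by
    rw [← map_smul, Finset.smul_sum]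
    exact congrArg _ (Finset.sum_congr rfl fun i _ => TensorProduct.tmul_smul _ _ _)
  map_zero' := by simp
  map_add' b b' := by
    rw [← map_add, ← Finset.sum_add_distrib]
    exact congrArg _ (Finset.sum_congr rfl fun i _ => TensorProduct.tmul_add _ _ _)
  map_mul' b b' := by
    rw [← map_mul, Finset.sum_mul_sum]
    refine congrArg _ (Finset.sum_congr rfl fun i _ => ?_)
    -- Orthogonality kills the off-diagonal terms and idempotence fixes the diagonal ones, so
    -- multiplication becomes coordinatewise.
    rw [Finset.sum_eq_single i (fun j _ hj => ?_) (by simp)]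
    · rw [Algebra.TensorProduct.tmul_mul_tmul, (hq i).isIdempotentElem]; rfl
    · rw [Algebra.TensorProduct.tmul_mul_tmul, ho hj.symm, TensorProduct.zero_tmul]
  map_star' b := by
    rw [← map_star, star_sum]
    refine congrArg _ (Finset.sum_congr rfl fun i _ => ?_)
    rw [TensorProduct.star_tmul, (hq i).isSelfAdjoint]; rfl

/-- A `*`-homomorphism of `C*`-algebras is contractive, and the norm of the finite product `ι → D`
is the maximum of the coordinate norms. The bound is therefore the same for every commuting pair. -/
theorem CommutingPair.norm_hom_sum_le (P : CommutingPair C D E) {ι : Type} [Fintype ι] {q : ι → C}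
    (hq : ∀ i, IsStarProjection (q i)) (ho : Pairwise fun i j => q i * q j = 0) (b : ι → D) :
    ‖P.hom (∑ i, q i ⊗ₜ b i)‖ ≤ ‖b‖ :=
  NonUnitalStarAlgHom.norm_apply_le (P.sumHom hq ho) b

end Projections

/-! ### Tensor products as algebras of functions -/

section Delta

variable {Γ : Type u} {A : Type v} [NonUnitalCStarAlgebra A]

theorem LInf.norm_le {E : Type v} [NonUnitalCStarAlgebra E] {f : LInf Γ E} {r : ℝ} (hr : 0 ≤ r)
    (h : ∀ y, ‖f y‖ ≤ r) : ‖f‖ ≤ r :=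
  lp.norm_le_of_forall_le hr h

theorem LInf.norm_apply_le {E : Type v} [NonUnitalCStarAlgebra E] (f : LInf Γ E) (y : Γ) :
    ‖f y‖ ≤ ‖f‖ :=
  lp.norm_apply_le_norm ENNReal.top_ne_zero f y

/-- The function `y ↦ f(y) ρ_y(a)`. -/
def twist (ρ : Γ → (A ≃⋆ₐ[ℂ] A)) (f : LInf Γ ℂ) (a : A) : LInf Γ A :=
  LInf.of (fun y => f y • ρ y a) (‖f‖ * ‖a‖) fun y => by
    rw [norm_smul]
    exact mul_le_mul (LInf.norm_apply_le f y)
      (NonUnitalStarAlgHom.norm_apply_le (ρ y : A →⋆ₙₐ[ℂ] A) a) (norm_nonneg _) (norm_nonneg _)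

theorem twist_sub (ρ : Γ → (A ≃⋆ₐ[ℂ] A)) (f g : LInf Γ ℂ) (a : A) :
    twist ρ (f - g) a = twist ρ f a - twist ρ g a :=
  lp.ext <| funext fun y => sub_smul (f y) (g y) (ρ y a)

variable {C : Type u} [NonUnitalCStarAlgebra C] (ev : C →⋆ₙₐ[ℂ] LInf Γ ℂ)
  (ρ : Γ → (A ≃⋆ₐ[ℂ] A))

/-- The `*`-homomorphism `c ⊗ a ↦ (y ↦ c(y) ρ_y(a))` of the algebraic tensor product. -/
def algDelta : C ⊗[ℂ] A →⋆ₙₐ[ℂ] LInf Γ A :=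
  let f : C ⊗[ℂ] A →ₗ[ℂ] LInf Γ A := TensorProduct.lift <|
    LinearMap.mk₂ ℂ (fun c a => twist ρ (ev c) a)
      (fun c c' a => lp.ext <| funext fun y => by
        rw [map_add]; exact add_smul (ev c y) (ev c' y) (ρ y a))
      (fun r c a => lp.ext <| funext fun y => by
        rw [map_smul]; exact smul_assoc r (ev c y) (ρ y a))
      (fun c a a' => lp.ext <| funext fun y => by
        change ev c y • ρ y (a + a') = ev c y • ρ y a + ev c y • ρ y a'
        rw [map_add, smul_add])
      (fun r c a => lp.ext <| funext fun y => by
        change ev c y • ρ y (r • a) = r • ev c y • ρ y a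
        rw [map_smul, smul_comm])
  have hf : ∀ c a, f (c ⊗ₜ a) = twist ρ (ev c) a := fun _ _ => rfl
  { toFun := f
    map_smul' := f.map_smul
    map_zero' := f.map_zero
    map_add' := f.map_add
    map_mul' := fun x y => by
      induction x using TensorProduct.induction_on with
      | zero => simp
      | add x₁ x₂ h₁ h₂ => rw [add_mul, map_add, h₁, h₂, map_add, add_mul]
      | tmul c a =>
        induction y using TensorProduct.induction_on with
        | zero => simp
        | add y₁ y₂ h₁ h₂ => rw [mul_add, map_add, h₁, h₂, map_add, mul_add]
        | tmul c' a' =>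
          rw [Algebra.TensorProduct.tmul_mul_tmul, hf, hf, hf]
          refine lp.ext (funext fun y => ?_)
          change ev (c * c') y • ρ y (a * a') = (ev c y • ρ y a) * (ev c' y • ρ y a')
          rw [map_mul, map_mul, smul_mul_smul_comm]; rfl
    map_star' := fun x => by
      change f (star x) = star (f x)
      induction x using TensorProduct.induction_on with
      | zero => simp
      | add x₁ x₂ h₁ h₂ => rw [star_add, map_add, h₁, h₂, map_add, star_add]
      | tmul c a =>
        rw [TensorProduct.star_tmul, hf, hf]
        refine lp.ext (funext fun y => ?_)
        change ev (star c) y • ρ y (star a) = star (ev c y • ρ y a)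
        rw [map_star, map_star, star_smul]; rfl }

/-- The commuting pair of the homomorphisms `c ↦ (y ↦ c(y) 1)` and `a ↦ (y ↦ ρ_y(a))` into the
bounded functions with values in the unitization of `A`. -/
def unitizationPair : CommutingPair C A (LInf Γ (Unitization ℂ A)) where
  left :=
    { toFun := fun c => LInf.of (fun y => algebraMap ℂ (Unitization ℂ A) (ev c y)) ‖ev c‖
        fun y => by rw [norm_algebraMap']; exact LInf.norm_apply_le (ev c) y
      map_smul' := fun r c => lp.ext <| funext fun y => by
        change algebraMap ℂ (Unitization ℂ A) (ev (r • c) y) = r • algebraMap ℂ _ (ev c y)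
        rw [map_smul, Algebra.algebraMap_eq_smul_one, Algebra.algebraMap_eq_smul_one]
        exact smul_assoc r (ev c y) 1
      map_zero' := lp.ext <| funext fun y => by
        change algebraMap ℂ (Unitization ℂ A) (ev 0 y) = 0
        rw [map_zero]; exact map_zero _
      map_add' := fun c c' => lp.ext <| funext fun y => by
        change algebraMap ℂ (Unitization ℂ A) (ev (c + c') y) =
          algebraMap ℂ _ (ev c y) + algebraMap ℂ _ (ev c' y)
        rw [map_add ev]; exact map_add (algebraMap ℂ (Unitization ℂ A)) (ev c y) (ev c' y)
      map_mul' := fun c c' => lp.ext <| funext fun y => by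
        change algebraMap ℂ (Unitization ℂ A) (ev (c * c') y) =
          algebraMap ℂ _ (ev c y) * algebraMap ℂ _ (ev c' y)
        rw [map_mul ev]; exact map_mul (algebraMap ℂ (Unitization ℂ A)) (ev c y) (ev c' y)
      map_star' := fun c => lp.ext <| funext fun y => by
        change algebraMap ℂ (Unitization ℂ A) (ev (star c) y) = star (algebraMap ℂ _ (ev c y))
        rw [map_star, ← algebraMap_star_comm]; rfl }
  right :=
    { toFun := fun a => LInf.of (fun y => (ρ y a : Unitization ℂ A)) ‖a‖ fun y => by
        rw [Unitization.norm_inr]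
        exact NonUnitalStarAlgHom.norm_apply_le (ρ y : A →⋆ₙₐ[ℂ] A) a
      map_smul' := fun r a => lp.ext <| funext fun y => by
        change ((ρ y (r • a) : A) : Unitization ℂ A) = r • ((ρ y a : A) : Unitization ℂ A)
        rw [map_smul, Unitization.inr_smul]
      map_zero' := lp.ext <| funext fun y => by
        change ((ρ y 0 : A) : Unitization ℂ A) = 0
        rw [map_zero, Unitization.inr_zero]
      map_add' := fun a b => lp.ext <| funext fun y => by
        change ((ρ y (a + b) : A) : Unitization ℂ A) = (ρ y a : A) + (ρ y b : A)
        rw [map_add, Unitization.inr_add]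
      map_mul' := fun a b => lp.ext <| funext fun y => by
        change ((ρ y (a * b) : A) : Unitization ℂ A) = (ρ y a : A) * (ρ y b : A)
        rw [map_mul, Unitization.inr_mul]
      map_star' := fun a => lp.ext <| funext fun y => by
        change ((ρ y (star a) : A) : Unitization ℂ A) = star ((ρ y a : A) : Unitization ℂ A)
        rw [map_star, Unitization.inr_star] }
  comm c a := lp.ext <| funext fun y =>
    Algebra.commutes (ev c y) ((ρ y a : A) : Unitization ℂ A)

/-- A may have no unit, so the scalar functions need not act from inside the A-valued functions.
After passing to the unitization, the product of the two legs takes its values in A again. -/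
theorem unitizationPair_hom_apply (x : C ⊗[ℂ] A) (y : Γ) :
    (unitizationPair ev ρ).hom x y = ((algDelta ev ρ x y : A) : Unitization ℂ A) := by
  induction x using TensorProduct.induction_on with
  | zero => rw [map_zero, map_zero]; exact (Unitization.inr_zero ℂ).symm
  | add x₁ x₂ h₁ h₂ =>
    rw [map_add, map_add]
    exact (congrArg₂ (· + ·) h₁ h₂).trans (Unitization.inr_add ℂ _ _).symm
  | tmul c a =>
    change algebraMap ℂ (Unitization ℂ A) (ev c y) * ((ρ y a : A) : Unitization ℂ A) =
      ((ev c y • ρ y a : A) : Unitization ℂ A)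
    rw [Unitization.inr_smul, Algebra.smul_def]

/-- The inclusion of A in its unitization is isometric, so the sup norm here is at most the norm
under one particular commuting pair. -/
theorem norm_algDelta_le (x : C ⊗[ℂ] A) :
    ‖algDelta ev ρ x‖ ≤ (maxSeminorm C A).toSeminorm x := by
  refine le_trans ?_ (norm_hom_le_maxSeminorm (unitizationPair ev ρ) x)
  refine LInf.norm_le (norm_nonneg _) fun y => ?_
  rw [← Unitization.norm_inr (𝕜 := ℂ), ← unitizationPair_hom_apply]
  exact LInf.norm_apply_le _ y

/-- The `*`-homomorphism `c ⊗ a ↦ (y ↦ c(y) ρ_y(a))` of the tensor product. -/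
def delta : CStarTensor C A →⋆ₙₐ[ℂ] LInf Γ A :=
  (CStarCompletion.lift (algDelta ev ρ) (norm_algDelta_le ev ρ) :
    CStarCompletion (maxSeminorm C A) →⋆ₙₐ[ℂ] LInf Γ A)

theorem delta_ofAlg (x : C ⊗[ℂ] A) : delta ev ρ (CStarTensor.ofAlg x) = algDelta ev ρ x :=
  CStarCompletion.lift_mk (algDelta ev ρ) (norm_algDelta_le ev ρ) x

theorem delta_tmul (c : C) (a : A) : delta ev ρ (CStarTensor.tmul c a) = twist ρ (ev c) a :=
  delta_ofAlg ev ρ (c ⊗ₜ a)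

/-- The projections of `C` separate the values of `∑ qᵢ ⊗ bᵢ`, if the `qᵢ` are orthogonal. -/
theorem norm_le_norm_algDelta_sum (hev : Function.Injective ev) {ι : Type} [Fintype ι] {q : ι → C}
    (hq : ∀ i, IsStarProjection (q i)) (ho : Pairwise fun i j => q i * q j = 0) (b : ι → A)
    (hb : ∀ i, q i = 0 → b i = 0) : ‖b‖ ≤ ‖algDelta ev ρ (∑ i, q i ⊗ₜ b i)‖ := by
  refine (pi_norm_le_iff_of_nonneg (norm_nonneg _)).2 fun i => ?_
  by_cases h0 : q i = 0
  · rw [hb i h0, norm_zero]; exact norm_nonneg _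
  -- Injectivity of `ev` makes the nonzero qᵢ a nonzero function. At such a point its value is a
  -- nonzero idempotent scalar, hence 1, and orthogonality makes the other qⱼ vanish there.
  obtain ⟨y, hy⟩ : ∃ y, ev (q i) y ≠ 0 := by
    by_contra! h
    exact h0 (hev ((lp.ext (funext h) : ev (q i) = 0).trans (map_zero ev).symm))
  have h1 : ∀ j, ev (q i * q j) y = ev (q i) y * ev (q j) y := fun j => by rw [map_mul]; rfl
  have hii : ev (q i) y = 1 := by
    have := h1 i
    rw [(hq i).isIdempotentElem] at this
    exact mul_left_cancel₀ hy (by rw [← this, mul_one])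
  have hij : ∀ j, j ≠ i → ev (q j) y = 0 := fun j hj => by
    have := h1 j
    rw [ho hj.symm, map_zero] at this
    exact (mul_eq_zero.1 this.symm).resolve_left hy
  -- Evaluation at y as an additive map, so that it can be taken through the finite sum.
  let e : LInf Γ A →+ A := ⟨⟨fun f => f y, rfl⟩, fun _ _ => rfl⟩
  have hval : algDelta ev ρ (∑ j, q j ⊗ₜ b j) y = ρ y (b i) := by
    change e (algDelta ev ρ (∑ j, q j ⊗ₜ b j)) = _
    rw [map_sum, map_sum, Finset.sum_eq_single i (fun j _ hj => ?_) (by simp)]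
    · change ev (q i) y • ρ y (b i) = _
      rw [hii, one_smul]
    · change ev (q j) y • ρ y (b j) = 0
      rw [hij j hj, zero_smul]
  -- Both the automorphism and its inverse are contractive.
  have hn : ‖b i‖ = ‖ρ y (b i)‖ := by
    refine le_antisymm ?_ (NonUnitalStarAlgHom.norm_apply_le (ρ y : A →⋆ₙₐ[ℂ] A) (b i))
    have := NonUnitalStarAlgHom.norm_apply_le ((ρ y).symm : A →⋆ₙₐ[ℂ] A) (ρ y (b i))
    have h : ((ρ y).symm : A →⋆ₙₐ[ℂ] A) (ρ y (b i)) = b i := (ρ y).symm_apply_apply _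
    rwa [h] at this
  rw [hn, ← hval]
  exact LInf.norm_apply_le _ y

/-- If `C` is an algebra of functions spanned by projections, then the homomorphism
`C ⊗ A → ℓ^∞(Γ, A)` is isometric. -/
theorem norm_delta (hev : Function.Injective ev) {S : Set C} (hS : ∀ p ∈ S, IsStarProjection p)
    (hd : closure (Submodule.span ℂ S : Set C) = Set.univ) (z : CStarTensor C A) :
    ‖delta ev ρ z‖ = ‖z‖ := by
  classical
  refine le_antisymm (NonUnitalStarAlgHom.norm_apply_le _ z) ?_
  -- The reverse inequality is a closed condition, so it is enough to have it on the dense span of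
  -- the tensors p ⊗ a with p in S.
  have hcl : IsClosed {z : CStarTensor C A | ‖z‖ ≤ ‖delta ev ρ z‖} :=
    isClosed_le continuous_norm (continuous_starHom (delta ev ρ)).norm
  refine closure_minimal (s := CStarTensor.ofAlg '' _) ?_ hcl
    (by rw [CStarTensor.closure_ofAlg_span (D := A) hd]; trivial)
  rintro _ ⟨x, hx, rfl⟩
  change ‖CStarTensor.ofAlg x‖ ≤ ‖delta ev ρ (CStarTensor.ofAlg x)‖
  rw [CStarTensor.norm_ofAlg, delta_ofAlg]
  obtain ⟨T, hT, hx⟩ := exists_finset_of_mem_span_tmul hx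
  have hcomm : ∀ c c' : C, c * c' = c' * c := fun c c' => hev (by
    rw [map_mul, map_mul]
    exact lp.ext (funext fun y => mul_comm (ev c y) (ev c' y)))
  obtain ⟨ι, _, q, hq, ho, hs⟩ := exists_orthogonal_projections hcomm T fun p hp => hS p (hT p hp)
  obtain ⟨b, rfl⟩ := hx ι q hs
  -- Where qᵢ = 0 the coefficient bᵢ is invisible to the tensor and to evaluation, yet it would
  -- count in max ‖bᵢ‖; it is reset to 0.
  have hb : ∑ i, q i ⊗ₜ[ℂ] b i = ∑ i, q i ⊗ₜ[ℂ] (if q i = 0 then 0 else b i) :=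
    Finset.sum_congr rfl fun i _ => by
      split_ifs with h
      · rw [h, TensorProduct.zero_tmul, TensorProduct.zero_tmul]
      · rfl
  rw [hb]
  -- The maximal norm is a supremum over commuting pairs. Each of them gives at most max ‖bᵢ‖, and
  -- evaluation at suitable points recovers this maximum.
  refine CStarSeminorm.sup_le (norm_nonneg _) ?_
  rintro _ ⟨E, _, P, rfl⟩
  exact (P.norm_hom_sum_le hq ho _).trans
    (norm_le_norm_algDelta_sum ev ρ hev hq ho _ fun i h => if_pos h)

/-- The range of `C ⊗ A → ℓ^∞(Γ, A)` is the `C*`-algebra generated by the images of the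
elementary tensors `c ⊗ a` with `c` in a set `S` with dense span. -/
theorem range_delta (hev : Function.Injective ev) {S : Set C} (hS : ∀ p ∈ S, IsStarProjection p)
    (hd : closure (Submodule.span ℂ S : Set C) = Set.univ) :
    Set.range (delta (A := A) ev ρ) = cstarGen {f | ∃ c ∈ S, ∃ a, f = twist ρ (ev c) a} := by
  set G : Set (LInf Γ A) := {f | ∃ c ∈ S, ∃ a, f = twist ρ (ev c) a}
  refine Set.Subset.antisymm ?_ ?_
  · have hcl : IsClosed {z : CStarTensor C A | delta ev ρ z ∈ cstarGen G} :=
      IsClosed.preimage (continuous_starHom (delta ev ρ))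
        (inferInstance : IsClosed (cstarGen G : Set (LInf Γ A)))
    rintro _ ⟨z, rfl⟩
    refine closure_minimal (s := CStarTensor.ofAlg '' _) ?_ hcl
      (by rw [CStarTensor.closure_ofAlg_span (D := A) hd]; trivial)
    rintro _ ⟨x, hx, rfl⟩
    change delta ev ρ (CStarTensor.ofAlg x) ∈ cstarGen G
    rw [delta_ofAlg]
    induction hx using Submodule.span_induction with
    | mem x hx =>
      obtain ⟨c, hc, a, rfl⟩ := hx
      exact subset_cstarGen _ ⟨c, hc, a, rfl⟩
    | zero => rw [map_zero]; exact zero_mem _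
    | add x y _ _ hx hy => rw [map_add]; exact add_mem hx hy
    | smul r x _ hx => rw [map_smul]; exact SMulMemClass.smul_mem r hx
  -- The isometric image of a complete space is closed, so the range is a closed `*`-subalgebra and
  -- contains the algebra generated by the elements it holds.
  · have hiso : Isometry (delta (A := A) ev ρ) :=
      AddMonoidHomClass.isometry_of_norm _ (norm_delta ev ρ hev hS hd)
    have hcl : IsClosed (Set.range (delta (A := A) ev ρ)) := hiso.isClosedEmbedding.isClosed_range
    have h : cstarGen G ≤ NonUnitalStarAlgHom.range (delta (A := A) ev ρ) := by
      refine cstarGen_le (by rw [NonUnitalStarAlgHom.coe_range]; exact hcl) ?_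
      rintro _ ⟨c, -, a, rfl⟩
      exact ⟨CStarTensor.tmul c a, delta_tmul ev ρ c a⟩
    intro f hf
    exact h hf

end Delta

/-! ### Isomorphisms onto generated algebras -/

section Equivalence

variable {Γ : Type u} {A : Type v} [NonUnitalCStarAlgebra A] {C : Type u}
  [NonUnitalCStarAlgebra C] (ev : C →⋆ₙₐ[ℂ] LInf Γ ℂ) (ρ : Γ → (A ≃⋆ₐ[ℂ] A))

/-- The isomorphism of `C ⊗ A` onto a generated `C*`-algebra of functions. -/
def deltaEquiv (hn : ∀ z : CStarTensor C A, ‖delta ev ρ z‖ = ‖z‖) {G : Set (LInf Γ A)}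
    (hr : Set.range (delta (A := A) ev ρ) = cstarGen G) : CStarTensor C A ≃⋆ₐ[ℂ] CStarGen G :=
  let f : CStarTensor C A →⋆ₙₐ[ℂ] cstarGen G :=
    NonUnitalStarAlgHom.codRestrict (delta ev ρ) (cstarGen G) fun z => by
      rw [← SetLike.mem_coe, ← hr]; exact ⟨z, rfl⟩
  (StarAlgEquiv.ofBijective f
    ⟨fun x y h => (AddMonoidHomClass.isometry_of_norm (delta ev ρ) hn).injective
        (congrArg Subtype.val h),
      fun y => by
        obtain ⟨z, hz⟩ : y.1 ∈ Set.range (delta (A := A) ev ρ) := by rw [hr]; exact y.2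
        exact ⟨z, Subtype.ext hz⟩⟩ : CStarTensor C A ≃⋆ₐ[ℂ] cstarGen G)

end Equivalence

/-! ### Generated `C*`-algebras inside the ambient algebra -/

section Generated

variable {D : Type*} [NonUnitalCStarAlgebra D] (S : Set D)

/-- The inclusion of `C*(S)` in the ambient algebra. -/
def CStarGen.val : CStarGen S →⋆ₙₐ[ℂ] D :=
  (NonUnitalStarSubalgebraClass.subtype (cstarGen S) : cstarGen S →⋆ₙₐ[ℂ] D)

theorem CStarGen.val_mk (y : D) (hy : y ∈ cstarGen S) :
    CStarGen.val S (⟨y, hy⟩ : cstarGen S) = y := rfl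

theorem CStarGen.val_incl_mk {S T : Set D} (h : S ⊆ cstarGen T) (y : D) (hy : y ∈ cstarGen S) :
    CStarGen.val T (CStarGen.incl h (⟨y, hy⟩ : cstarGen S)) = y := rfl

theorem CStarGen.val_injective : Function.Injective (CStarGen.val S) :=
  fun _ _ h => Subtype.ext h

theorem CStarGen.val_incl {S T : Set D} (h : S ⊆ cstarGen T) (x : CStarGen S) :
    CStarGen.val T (CStarGen.incl h x) = CStarGen.val S x := by
  obtain ⟨y, hy⟩ := x
  exact (CStarGen.val_incl_mk h y hy).trans (CStarGen.val_mk S y hy).symm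

theorem CStarGen.incl_injective {S T : Set D} (h : S ⊆ cstarGen T) :
    Function.Injective (CStarGen.incl h) := fun x y hxy => CStarGen.val_injective S <| by
  rw [← CStarGen.val_incl h, ← CStarGen.val_incl h, hxy]

theorem CStarGen.val_restrictAction {G : Type*} [Group G] (σ : G →* (D ≃⋆ₐ[ℂ] D)) {S : Set D}
    (hS : ∀ g, ∀ x ∈ S, σ g x ∈ S) (g : G) (x : CStarGen S) :
    CStarGen.val S (restrictAction σ S hS g x) = σ g (CStarGen.val S x) := rfl

theorem CStarGen.exists_val {S : Set D} {x : D} (hx : x ∈ S) : ∃ c, CStarGen.val S c = x :=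
  ⟨(⟨x, subset_cstarGen S hx⟩ : cstarGen S), rfl⟩

/-- The generated algebra carries the induced topology, so density of the span inside it is the
description of its underlying set as a closed span in `D`. This supplies the density hypothesis of
`norm_delta` for B_Γ and B_{Γ,∞}. -/
theorem CStarGen.closure_span_preimage {S : Set D}
    (h : (cstarGen S : Set D) = closure (Submodule.span ℂ S)) :
    closure (Submodule.span ℂ (CStarGen.val S ⁻¹' S) : Set (CStarGen S)) = Set.univ := by
  have hind : Topology.IsInducing (CStarGen.val S) := Topology.IsInducing.subtypeVal
  let L : CStarGen S →ₗ[ℂ] D := (CStarGen.val S : CStarGen S →ₗ[ℂ] D)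
  have him : CStarGen.val S '' (Submodule.span ℂ (CStarGen.val S ⁻¹' S) : Set (CStarGen S)) =
      Submodule.span ℂ S := by
    have h1 := congrArg (fun T : Submodule ℂ D => (T : Set D))
      (Submodule.map_span L (CStarGen.val S ⁻¹' S))
    have h2 : L '' (CStarGen.val S ⁻¹' S) = S := by
      refine Set.image_preimage_eq_iff.2 fun x hx => ?_
      exact CStarGen.exists_val hx
    rw [h2] at h1
    exact h1
  rw [hind.closure_eq_preimage_closure_image, him, ← h]
  exact Set.eq_univ_of_forall fun x => x.2

end Generated

/-! ### Functoriality of the crossed product -/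

section Crossed

variable {G : Type v} {D D' D'' : Type w} [Group G] [NonUnitalCStarAlgebra D]
  [NonUnitalCStarAlgebra D'] [NonUnitalCStarAlgebra D''] {σ : G →* (D ≃⋆ₐ[ℂ] D)}
  {σ' : G →* (D' ≃⋆ₐ[ℂ] D')} {σ'' : G →* (D'' ≃⋆ₐ[ℂ] D'')}

theorem crossedMap_single (φ : D →⋆ₙₐ[ℂ] D') (hφ : ∀ g d, φ (σ g d) = σ' g (φ d)) (s : G) (a : D) :
    crossedMap φ hφ (crossedMk σ (CcAlg.single σ s a)) =
      crossedMk σ' (CcAlg.single σ' s (φ a)) := by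
  unfold crossedMap
  refine (CStarCompletion.map_mk _ _ (CcAlg.single σ s a)).trans ?_
  exact congrArg (crossedMk σ') (CcAlg.lift_single _ s a)

/-- The elements a δ_s span the dense image of C_c(G, D), and `*`-homomorphisms of `C*`-algebras are
automatically continuous. -/
theorem CrossedProduct.hom_ext {F : Type*} [NonUnitalCStarAlgebra F]
    {f g : CrossedProduct σ →⋆ₙₐ[ℂ] F}
    (h : ∀ s a, f (crossedMk σ (CcAlg.single σ s a)) = g (crossedMk σ (CcAlg.single σ s a))) :
    f = g := by
  refine NonUnitalStarAlgHom.ext fun x => ?_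
  induction x using crossed_induction_on with
  | hp => exact isClosed_eq (continuous_starHom f) (continuous_starHom g)
  | ih x =>
    induction x using CcAlg.induction with
    | zero => simp
    | add x y hx hy => rw [map_add, map_add, hx, hy, map_add]
    | single s a => exact h s a

/-- The composite χ is a separate argument tied to ψ ∘ φ only pointwise, so two factorizations of
one homomorphism can be compared through the same χ. -/
theorem crossedMap_comp (φ : D →⋆ₙₐ[ℂ] D') (hφ : ∀ g d, φ (σ g d) = σ' g (φ d))
    (ψ : D' →⋆ₙₐ[ℂ] D'') (hψ : ∀ g d, ψ (σ' g d) = σ'' g (ψ d)) (χ : D →⋆ₙₐ[ℂ] D'')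
    (hχ : ∀ g d, χ (σ g d) = σ'' g (χ d)) (h : ∀ d, ψ (φ d) = χ d) (x : CrossedProduct σ) :
    crossedMap ψ hψ (crossedMap φ hφ x) = crossedMap χ hχ x := by
  have : (crossedMap ψ hψ).comp (crossedMap φ hφ) = crossedMap χ hχ :=
    CrossedProduct.hom_ext fun s a => by
      rw [NonUnitalStarAlgHom.comp_apply, crossedMap_single, crossedMap_single, crossedMap_single,
        h]
  exact DFunLike.congr_fun this x

theorem crossedMap_id (φ : D →⋆ₙₐ[ℂ] D) (hφ : ∀ g d, φ (σ g d) = σ g (φ d)) (h : ∀ d, φ d = d)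
    (x : CrossedProduct σ) : crossedMap φ hφ x = x := by
  have : crossedMap φ hφ = NonUnitalStarAlgHom.id ℂ _ :=
    CrossedProduct.hom_ext fun s a => by rw [crossedMap_single, h]; rfl
  exact DFunLike.congr_fun this x

/-- The isomorphism of crossed products induced by an invertible equivariant homomorphism. -/
def crossedEquiv (φ : D →⋆ₙₐ[ℂ] D') (hφ : ∀ g d, φ (σ g d) = σ' g (φ d)) (ψ : D' →⋆ₙₐ[ℂ] D)
    (hψφ : ∀ d, ψ (φ d) = d) (hφψ : ∀ d, φ (ψ d) = d) :
    CrossedProduct σ ≃⋆ₐ[ℂ] CrossedProduct σ' :=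
  -- The inverse of an equivariant bijection is equivariant.
  have hψ : ∀ g d, ψ (σ' g d) = σ g (ψ d) := fun g d => by
    conv_lhs => rw [← hφψ d, ← hφ, hψφ]
  StarAlgEquiv.ofBijective (crossedMap φ hφ) (Function.bijective_iff_has_inverse.2
    ⟨crossedMap ψ hψ, fun x => by
      rw [crossedMap_comp φ hφ ψ hψ (NonUnitalStarAlgHom.id ℂ D) (fun _ _ => rfl) hψφ]
      exact crossedMap_id _ _ (fun _ => rfl) x, fun x => by
      rw [crossedMap_comp ψ hψ φ hφ (NonUnitalStarAlgHom.id ℂ D') (fun _ _ => rfl) hφψ]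
      exact crossedMap_id _ _ (fun _ => rfl) x⟩)

/-- Right multiplication by the multiplier of s carries d δ_1 to d δ_s. This translates the
prescribed formula for Δ into one on the elements d δ_s. -/
theorem mulMultiplier_crossedIncl_crossedGroup (σ : G →* (D ≃⋆ₐ[ℂ] D)) (d : D) (s : G) :
    mulMultiplier (crossedIncl σ d) (crossedGroup σ s) = crossedMk σ (CcAlg.single σ s d) := by
  refine (CStarCompletion.mapL_mk (rightDelta σ s) (crossedSeminorm_rightDelta_le s)
    (CcAlg.single σ 1 d)).trans ?_
  rw [rightDelta_single, one_mul]; rfl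

end Crossed

/-! ### The isomorphism δ for the systems over Γ -/

section Systems

variable {Γ : Type u} [AddCommGroup Γ] [LinearOrder Γ] [IsOrderedAddMonoid Γ]
  {A : Type v} [NonUnitalCStarAlgebra A]

theorem isStarProjection_oneFrom (s : Γ) : IsStarProjection (oneFrom s) :=
  ⟨by rw [IsIdempotentElem, oneFrom_mul_oneFrom, max_self], star_oneFrom s⟩

theorem isStarProjection_oneFrom_sub {s t : Γ} (h : s ≤ t) :
    IsStarProjection (oneFrom s - oneFrom t) := by
  refine ⟨?_, ?_⟩
  · rw [IsIdempotentElem, sub_mul, mul_sub, mul_sub]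
    simp only [oneFrom_mul_oneFrom, max_self, max_eq_left h, max_eq_right h]
    abel
  · rw [IsSelfAdjoint, star_sub, star_oneFrom, star_oneFrom]

/-- This is the group law of the extended action, so it holds whatever the signs of x, y and y - x.
-/
theorem extFun_sub_apply (α : PosCone Γ →* (A ≃⋆ₐ[ℂ] A)) (x y : Γ) (a : A) :
    extFun α (y - x) (extFun α x a) = extFun α y a := by
  have h := map_mul (extAction α) (Multiplicative.ofAdd (y - x)) (Multiplicative.ofAdd x)
  rw [← ofAdd_add, sub_add_cancel] at h
  exact (DFunLike.congr_fun h a).symm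

theorem extFun_of_nonneg (α : PosCone Γ →* (A ≃⋆ₐ[ℂ] A)) {x : Γ} (hx : 0 ≤ x) :
    extFun α x = α (PosCone.of x hx) := dif_pos hx

/-- For y ≥ x, the factorization α_y = α_{y-x} α_x exhibits y ↦ α_y(a) as the forward orbit of
α_x(a) starting at x; below x both sides vanish. -/
theorem twist_oneFrom (α : PosCone Γ →* (A ≃⋆ₐ[ℂ] A)) (x : Γ) (a : A) :
    twist (extFun α) (oneFrom x) a = mu (toEnd α) x (extFun α x a) := by
  refine lp.ext (funext fun y => ?_)
  change (if x ≤ y then (1 : ℂ) else 0) • extFun α y a =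
    if h : x ≤ y then α (PosCone.of (y - x) (sub_nonneg.2 h)) (extFun α x a) else 0
  split_ifs with h
  · rw [one_smul, ← extFun_sub_apply α x y a]
    exact DFunLike.congr_fun (extFun_of_nonneg α (sub_nonneg.2 h)) _
  · exact zero_smul _ _

theorem genB_eq (α : PosCone Γ →* (A ≃⋆ₐ[ℂ] A)) :
    {f | ∃ c ∈ CStarGen.val (genBGamma Γ) ⁻¹' genBGamma Γ, ∃ a,
      f = twist (extFun α) (CStarGen.val _ c) a} = genB (toEnd α) := by
  ext f
  constructor
  · rintro ⟨c, ⟨s, hs⟩, a, rfl⟩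
    exact ⟨s, _, by rw [hs, twist_oneFrom]⟩
  · rintro ⟨x, a, rfl⟩
    obtain ⟨c, hc⟩ := CStarGen.exists_val (S := genBGamma Γ) ⟨x, rfl⟩
    -- The witness α_x⁻¹(a) undoes the α_x produced by `twist_oneFrom`; invertibility of the action
    -- is essential at this point.
    refine ⟨c, ⟨x, hc⟩, (extFun α x).symm a, ?_⟩
    rw [hc, twist_oneFrom, StarAlgEquiv.apply_symm_apply]

/-- Both terms come from the same a: α_{t-s}(α_s(a)) = α_t(a), which is the compatibility built into
the generators of 𝓘. -/
theorem twist_oneFrom_sub (α : PosCone Γ →* (A ≃⋆ₐ[ℂ] A)) {s t : Γ} (h : s < t) (a : A) :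
    twist (extFun α) (oneFrom s - oneFrom t) a = mu (toEnd α) s (extFun α s a) -
      mu (toEnd α) t (toEnd α (PosCone.of (t - s) (sub_nonneg.2 h.le)) (extFun α s a)) := by
  have h1 : toEnd α (PosCone.of (t - s) (sub_nonneg.2 h.le)) (extFun α s a) = extFun α t a := by
    rw [← extFun_sub_apply α s t a]
    exact (DFunLike.congr_fun (extFun_of_nonneg α (sub_nonneg.2 h.le)) _).symm
  rw [twist_sub, twist_oneFrom, twist_oneFrom, h1]

theorem genI_eq (α : PosCone Γ →* (A ≃⋆ₐ[ℂ] A)) :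
    {f | ∃ c ∈ CStarGen.val (genBGammaInf Γ) ⁻¹' genBGammaInf Γ, ∃ a,
      f = twist (extFun α) (CStarGen.val _ c) a} = genI (toEnd α) := by
  ext f
  constructor
  · rintro ⟨c, ⟨s, t, h, hs⟩, a, rfl⟩
    exact ⟨s, t, h, _, by rw [hs, twist_oneFrom_sub α h]⟩
  · rintro ⟨s, t, h, a, rfl⟩
    obtain ⟨c, hc⟩ := CStarGen.exists_val (S := genBGammaInf Γ) ⟨s, t, h, rfl⟩
    refine ⟨c, ⟨s, t, h, hc⟩, (extFun α s).symm a, ?_⟩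
    rw [hc, twist_oneFrom_sub α h, StarAlgEquiv.apply_symm_apply]

theorem isStarProjection_of_val {D : Type*} [NonUnitalCStarAlgebra D] {S : Set D}
    (hS : ∀ p ∈ S, IsStarProjection p) :
    ∀ p ∈ CStarGen.val S ⁻¹' S, IsStarProjection p := fun p hp =>
  ⟨CStarGen.val_injective S ((map_mul _ p p).trans (hS _ hp).isIdempotentElem),
    CStarGen.val_injective S ((map_star _ p).trans (hS _ hp).isSelfAdjoint)⟩

theorem isStarProjection_of_mem_genBGamma : ∀ p ∈ genBGamma Γ, IsStarProjection p := by
  rintro _ ⟨s, rfl⟩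
  exact isStarProjection_oneFrom s

theorem isStarProjection_of_mem_genBGammaInf : ∀ p ∈ genBGammaInf Γ, IsStarProjection p := by
  rintro _ ⟨s, t, h, rfl⟩
  exact isStarProjection_oneFrom_sub h.le

/-- The isomorphism `δ : B_Γ ⊗ A → 𝓑`. -/
def deltaB (α : PosCone Γ →* (A ≃⋆ₐ[ℂ] A)) : CStarTensor (BGamma Γ) A ≃⋆ₐ[ℂ] BAlg (toEnd α) :=
  deltaEquiv (CStarGen.val (genBGamma Γ)) (extFun α)
    (norm_delta _ _ (CStarGen.val_injective _)
      (isStarProjection_of_val isStarProjection_of_mem_genBGamma)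
      (CStarGen.closure_span_preimage (coe_cstarGen_genBGamma Γ)))
    ((range_delta _ _ (CStarGen.val_injective _)
      (isStarProjection_of_val isStarProjection_of_mem_genBGamma)
      (CStarGen.closure_span_preimage (coe_cstarGen_genBGamma Γ))).trans
      (congrArg (fun T => (cstarGen T : Set (LInf Γ A))) (genB_eq α)))

/-- The restriction of `δ` to an isomorphism `B_{Γ,∞} ⊗ A → 𝓘`. -/
def deltaI (α : PosCone Γ →* (A ≃⋆ₐ[ℂ] A)) :
    CStarTensor (BGammaInf Γ) A ≃⋆ₐ[ℂ] IAlg (toEnd α) :=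
  deltaEquiv (CStarGen.val (genBGammaInf Γ)) (extFun α)
    (norm_delta _ _ (CStarGen.val_injective _)
      (isStarProjection_of_val isStarProjection_of_mem_genBGammaInf)
      (CStarGen.closure_span_preimage (coe_cstarGen_genBGammaInf Γ)))
    ((range_delta _ _ (CStarGen.val_injective _)
      (isStarProjection_of_val isStarProjection_of_mem_genBGammaInf)
      (CStarGen.closure_span_preimage (coe_cstarGen_genBGammaInf Γ))).trans
      (congrArg (fun T => (cstarGen T : Set (LInf Γ A))) (genI_eq α)))

theorem val_deltaB (α : PosCone Γ →* (A ≃⋆ₐ[ℂ] A)) (z : CStarTensor (BGamma Γ) A) :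
    CStarGen.val _ (deltaB α z) = delta (CStarGen.val _) (extFun α) z := rfl

theorem val_deltaI (α : PosCone Γ →* (A ≃⋆ₐ[ℂ] A)) (z : CStarTensor (BGammaInf Γ) A) :
    CStarGen.val _ (deltaI α z) = delta (CStarGen.val _) (extFun α) z := rfl

/-- Both maps are given by the same formula c ⊗ a ↦ (y ↦ c(y) α_y(a)) once everything is viewed in
ℓ^∞(Γ, A). The ideal statements, for the algebras and for the crossed products, rest on this square.
-/
theorem deltaB_inclTensor (α : PosCone Γ →* (A ≃⋆ₐ[ℂ] A)) (z : CStarTensor (BGammaInf Γ) A) :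
    deltaB α (inclTensor Γ A z) = inclI (toEnd α) (deltaI α z) := by
  refine CStarGen.val_injective _ ?_
  refine (val_deltaB α _).trans (Eq.trans ?_
    ((CStarGen.val_incl (genI_subset (toEnd α)) _).trans (val_deltaI α z)).symm)
  refine CStarTensor.hom_ext
    (f := (delta (CStarGen.val _) (extFun α)).comp (inclTensor Γ A))
    (g := delta (CStarGen.val _) (extFun α)) (continuous_starHom _) (continuous_starHom _)
    (fun c a => ?_) z
  rw [NonUnitalStarAlgHom.comp_apply, inclTensor, tensorMap_tmul, delta_tmul, delta_tmul,
    inclBGammaInf, CStarGen.val_incl]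
  rfl

/-- Translation by x also moves the twisting automorphism from α_y to α_{y-x} = α_y α_x⁻¹. This is
why α⁻¹, and not α, accompanies τ. -/
theorem shift_twist (α : PosCone Γ →* (A ≃⋆ₐ[ℂ] A)) (x : Multiplicative Γ) (f : LInf Γ ℂ) (a : A) :
    shift Γ A x (twist (extFun α) f a) =
      twist (extFun α) (shift Γ ℂ x f) ((extAction α x)⁻¹ a) := by
  refine lp.ext (funext fun y => ?_)
  change f (y - x.toAdd) • extFun α (y - x.toAdd) a =
    f (y - x.toAdd) • extFun α y ((extFun α x.toAdd)⁻¹ a)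
  rw [← extFun_sub_apply α x.toAdd y, ← StarAlgEquiv.mul_apply (extFun α x.toAdd),
    mul_inv_cancel, StarAlgEquiv.one_apply]

theorem beta_deltaB (α : PosCone Γ →* (A ≃⋆ₐ[ℂ] A)) (x : Multiplicative Γ)
    (z : CStarTensor (BGamma Γ) A) :
    beta (toEnd α) x (deltaB α z) = deltaB α (tauTensor α x z) := by
  refine CStarGen.val_injective _ ?_
  refine (CStarGen.val_restrictAction _ (shift_mem_genB (toEnd α)) x _).trans ?_
  rw [val_deltaB, val_deltaB]
  let d : CStarTensor (BGamma Γ) A →⋆ₙₐ[ℂ] LInf Γ A := delta (CStarGen.val _) (extFun α)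
  refine CStarTensor.hom_ext
    (f := (shift Γ A x : LInf Γ A →⋆ₙₐ[ℂ] LInf Γ A).comp d)
    (g := d.comp (tauTensor α x : CStarTensor (BGamma Γ) A →⋆ₙₐ[ℂ] CStarTensor (BGamma Γ) A))
    (continuous_starHom _) (continuous_starHom _) (fun c a => ?_) z
  rw [NonUnitalStarAlgHom.comp_apply, NonUnitalStarAlgHom.comp_apply]
  have h1 : (tauTensor α x : CStarTensor (BGamma Γ) A →⋆ₙₐ[ℂ] CStarTensor (BGamma Γ) A)
      (CStarTensor.tmul c a) = CStarTensor.tmul (tau Γ x c) ((extAction α x)⁻¹ a) :=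
    tensorAction_tmul _ _ _ _ _
  rw [h1]
  simp only [d, delta_tmul]
  rw [tau, CStarGen.val_restrictAction]
  exact shift_twist α x _ a

/-- The inclusion of 𝓘 in 𝓑 is injective and equivariant, so the identity is inherited from 𝓑
through the commuting square. -/
theorem betaI_deltaI (α : PosCone Γ →* (A ≃⋆ₐ[ℂ] A)) (x : Multiplicative Γ)
    (z : CStarTensor (BGammaInf Γ) A) :
    betaI (toEnd α) x (deltaI α z) = deltaI α (tauTensorInf α x z) := by
  refine CStarGen.incl_injective (genI_subset (toEnd α)) ?_
  change inclI (toEnd α) _ = inclI (toEnd α) _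
  rw [inclI_equivariant, ← deltaB_inclTensor, ← deltaB_inclTensor, inclTensor_equivariant,
    beta_deltaB]

end Systems

end PisoCrossed

end

/-! ### The theorem -/

open PisoCrossed in
theorem proposition5p1 {Γ : Type*} [AddCommGroup Γ] [LinearOrder Γ] [IsOrderedAddMonoid Γ]
    {A : Type*} [NonUnitalCStarAlgebra A] (α : PosCone Γ →* (A ≃⋆ₐ[ℂ] A)) :
    ∃ δ : CStarTensor (BGamma Γ) A ≃⋆ₐ[ℂ] BAlg (toEnd α),
      (∀ (x : Multiplicative Γ) (ξ : CStarTensor (BGamma Γ) A),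
        beta (toEnd α) x (δ ξ) = δ (tauTensor α x ξ)) ∧
      δ '' Set.range (inclTensor Γ A) = Set.range (inclI (toEnd α)) ∧
      ∃ Δ : CrossedProduct (tauTensor α) ≃⋆ₐ[ℂ] CrossedProduct (beta (toEnd α)),
        (∀ (ξ : CStarTensor (BGamma Γ) A) (s : Multiplicative Γ),
          Δ (mulMultiplier (crossedIncl (tauTensor α) ξ) (crossedGroup (tauTensor α) s)) =
            mulMultiplier (crossedIncl (beta (toEnd α)) (δ ξ))
              (crossedGroup (beta (toEnd α)) s)) ∧
        Δ '' Set.range (crossedMap (inclTensor Γ A) (inclTensor_equivariant α)) =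
          Set.range (crossedMap (inclI (toEnd α)) (inclI_equivariant (toEnd α))) := by
  let d : CStarTensor (BGamma Γ) A →⋆ₙₐ[ℂ] BAlg (toEnd α) := deltaB α
  let d' : CStarTensor (BGammaInf Γ) A →⋆ₙₐ[ℂ] IAlg (toEnd α) := deltaI α
  have hd : ∀ x z, d (tauTensor α x z) = beta (toEnd α) x (d z) :=
    fun x z => (beta_deltaB α x z).symm
  have hd' : ∀ x z, d' (tauTensorInf α x z) = betaI (toEnd α) x (d' z) :=
    fun x z => (betaI_deltaI α x z).symm
  let E := crossedEquiv d hd (deltaB α).symm (deltaB α).symm_apply_apply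
    (deltaB α).apply_symm_apply
  let E' := crossedEquiv d' hd' (deltaI α).symm (deltaI α).symm_apply_apply
    (deltaI α).apply_symm_apply
  refine ⟨deltaB α, beta_deltaB α, ?_, E, fun ξ s => ?_, ?_⟩
  -- Since `deltaI α` is onto, the range of the inclusion of 𝓘 is unchanged by composing with it
  -- first, and the two composites agree.
  · rw [← Set.range_comp, ← (deltaI α).surjective.range_comp (inclI (toEnd α))]
    exact congrArg Set.range (funext (deltaB_inclTensor α))
  · rw [mulMultiplier_crossedIncl_crossedGroup, mulMultiplier_crossedIncl_crossedGroup]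
    exact crossedMap_single d hd s ξ
  -- The same argument one level up, with `E'` the isomorphism between the crossed products of the
  -- ideals.
  · rw [← Set.range_comp, ← E'.surjective.range_comp (crossedMap (inclI (toEnd α)) _)]
    refine congrArg Set.range (funext fun z => ?_)
    -- The diagonal of the square is equivariant; both paths around the square of crossed products
    -- equal the map it induces.
    have hχ : ∀ x z, (d.comp (inclTensor Γ A)) (tauTensorInf α x z) =
        beta (toEnd α) x ((d.comp (inclTensor Γ A)) z) := fun x z =>
      (congrArg d (inclTensor_equivariant α x z)).trans (hd x _)
    exact (crossedMap_comp _ _ d hd _ hχ (fun _ => rfl) z).trans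
      (crossedMap_comp d' hd' _ _ _ hχ (fun z => (deltaB_inclTensor α z).symm) z).symm
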